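/- **Conventions.** Ideals are closed and two-sided. A $C^*$-precategory $\mathcal T$ with objects $\mathbb N=\{0,1,2,\dots\}$ consists of complex Banach spaces $\mathcal T(n,m)$ of morphisms from $n$ to $m$, with an associative bilinear composition satisfying $\|ab\|\le\|a\|\,\|b\|$ and an antilinear involution $*:\mathcal T(n,m)\to\mathcal T(m,n)$ satisfying $(ab)^*=b^*a^*$, $a^{**}=a$, $\|a^*a\|=\|a\|^2$; it is a $C^*$-category if every object has an identity morphism. A right tensor $C^*$-(pre)category is such a $\mathcal T$ with a $*$-preserving, multiplicative, linear endomorphism $\otimes 1:\mathcal T(n,m)\to\mathcal T(n+1,m+1)$; $\otimes 1^k$ denotes its iterates. An ideal $\mathcal K$ in $\mathcal T$ is a family of closed subspaces $\mathcal K(n,m)\subset\mathcal T(n,m)$ stable under composition with arbitrary morphisms on both sides. Put $J(\mathcal K):=(\otimes 1)^{-1}(\mathcal K)\cap\mathcal K$, and let $\mathcal K^\perp$ be the ideal of all $a$ with $ab=0$ for every composable $b\in\mathcal K$. An ideal $\mathcal N$ is invariant if $\mathcal N\otimes 1\subset\mathcal N$; then $\mathcal T/\mathcal N$, with spaces $\mathcal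 T(n,m)/\mathcal N(n,m)$, is a right tensor $C^*$-precategory. A right tensor representation of $\mathcal K$ in a $C^*$-algebra $B$ is a family of linear maps $\pi_{nm}:\mathcal K(m,n)\to B$ with $\pi_{nm}(a)^*=\pi_{mn}(a^*)$, $\pi_{nm}(a)\pi_{ml}(b)=\pi_{nl}(ab)$ and $\pi_{nm}(a)\pi_{m+k,l}(b)=\pi_{n+k,l}((a\otimes1^k)b)$ for $k\in\mathbb N$; it is coisometric on an ideal $\mathcal J\subset J(\mathcal K)$ if $\pi_{nm}(a)=\pi_{n+1,m+1}(a\otimes 1)$ for all $a\in\mathcal J(m,n)$. $\mathcal O_{\mathcal T}(\mathcal K,\mathcal J)$ is the universal $C^*$-algebra for right tensor representations of $\mathcal K$ coisometric on $\mathcal J$, with universal representation $i$. The reduction ideal $\mathcal R_{\mathcal J}$ is the $\mathcal J$-saturation of $\{0\}$: $\mathcal R_{\mathcal J}=\sum_{k\ge0}\mathcal S_k$ (closed linear span in each morphism space), where $\mathcal S_0=\{0\}$ and $\mathcal S_k=\mathcal J\cap(\otimes 1)^{-1}(\mathcal S_{k-1})$ for $k>0$. **Theorem.** (1) Let $\mathcal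 K$ be an ideal in a right tensor $C^*$-precategory $\mathcal T$ and $\mathcal J$ an ideal contained in $J(\mathcal K)$. Then $\mathcal R_{\mathcal J}$ is invariant and $\mathcal R_{\mathcal J}\subset\mathcal J\subset\mathcal K$, so that $\mathcal T_{\mathcal R}:=\mathcal T/\mathcal R_{\mathcal J}$ is a right tensor $C^*$-precategory (a right tensor $C^*$-category if $\mathcal T$ is one), with right tensoring $\otimes1_{\mathcal R}$, and $\mathcal K_{\mathcal R}:=\mathcal K/\mathcal R_{\mathcal J}$, $\mathcal J_{\mathcal R}:=\mathcal J/\mathcal R_{\mathcal J}$ are ideals in it. Moreover $$\mathcal J_{\mathcal R}\subset J(\mathcal K_{\mathcal R})\cap(\ker\otimes1_{\mathcal R})^\perp,$$ and there is a natural $*$-isomorphism $\mathcal O_{\mathcal T}(\mathcal K,\mathcal J)\cong\mathcal O_{\mathcal T_{\mathcal R}}(\mathcal K_{\mathcal R},\mathcal J_{\mathcal R})$, which sends $i_{nm}(a)$ to $i_{nm}(a+\mathcal R_{\mathcal J}(m,n))$ for all $a\in\mathcal K(m,n)$. (2) Let $X$ be a $C^*$-correspondence over a $C^*$-algebra $A$,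 i.e. a right Hilbert $A$-module with a $*$-homomorphism $\phi:A\to\mathcal L(X)$ into the adjointable operators, and let $J$ be an ideal of $A$ contained in $J(X):=\phi^{-1}(\mathcal K(X))$, where $\mathcal K(X)=\overline{\mathrm{span}}\{\Theta_{x,y}\}$, $\Theta_{x,y}(z)=x\langle y,z\rangle$. For an ideal $I$ of $A$ put $XI=\{xi:x\in X,i\in I\}=\{x\in X:\langle x,y\rangle\in I\text{ for all }y\in X\}$, and call $I$ $X$-invariant if $\phi(I)X\subset XI$; then $X/XI$ is a $C^*$-correspondence over $A/I$. Let $R_J=\overline{\sum_{k\ge0}S_k}$ with $S_0=\{0\}$ and $S_k=\{a\in J:\phi(a)X\subset XS_{k-1}\}$ for $k>0$. Let $\mathcal O(J,X)$ be the relative Cuntz–Pimsner algebra: the universal $C^*$-algebra, with universal representation $(i_A,i_X)$, for pairs $(\pi,t)$ consisting of a $*$-homomorphism $\pi:A\to B$ and a linear map $t:X\to B$ into a $C^*$-algebra $B$ with $t(xa)=t(x)\pi(a)$, $t(\phi(a)x)=\pi(a)t(x)$, $t(x)^*t(y)=\pi(\langle x,y\rangle)$, which are coisometric on $J$: $\pi(a)=\pi_{11}(\phi(a))$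 for $a\in J$, where $\pi_{11}:\mathcal K(X)\to B$ is the continuous linear map with $\pi_{11}(\Theta_{x,y})=t(x)t(y)^*$. Then $R_J$ is $X$-invariant and contained in $J$. Putting $X_R:=X/XR_J$, $A_R:=A/R_J$ and $J_R:=J/R_J$, with left action $\phi_R$ of $A_R$ on $X_R$, one has $$J_R\subset J(X_R)\cap(\ker\phi_R)^\perp,$$ where $(\ker\phi_R)^\perp=\{a\in A_R: a\ker\phi_R=0\}$, and there is a natural $*$-isomorphism $\mathcal O(J,X)\cong\mathcal O(J_R,X_R)$, which sends $i_A(a)$ to $i_{A_R}(a+R_J)$ and $i_X(x)$ to $i_{X_R}(x+XR_J)$ for all $a\in A$, $x\in X$. -/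

import Mathlib

universe u v w

/-- A closed two-sided ideal of a C⋆-algebra (not necessarily unital). -/
structure ClosedIdeal (A : Type u) [NonUnitalCStarAlgebra A] extends Submodule ℂ A where
  mul_mem_left' : ∀ (a : A) {b : A}, b ∈ carrier → a * b ∈ carrier
  mul_mem_right' : ∀ (a : A) {b : A}, b ∈ carrier → b * a ∈ carrier
  isClosed' : IsClosed carrier

namespace ClosedIdeal
variable {A : Type u} [NonUnitalCStarAlgebra A]

theorem exists_local_unit (I : ClosedIdeal A) {c : A} (hc : c ∈ I.toSubmodule)
    (hs : star c = c) {ε : ℝ} (hε : 0 < ε) :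
    ∃ e ∈ I.toSubmodule, star e = e ∧ ‖e‖ ≤ 1 ∧ (∀ x : A, ‖x - x * e‖ ≤ ‖x‖) ∧ ‖c - c * e‖ < ε := by
  have hsa : IsSelfAdjoint c := hs
  set δ : ℝ := ε ^ 2 with hδ
  have hδ0 : 0 < δ := by positivity
  have hpos : ∀ t : ℝ, 0 < t ^ 2 + δ := fun t => by positivity
  let h : ℝ → ℝ := fun t => t / (t ^ 2 + δ)
  have hcont : Continuous h := by
    refine Continuous.div (by fun_prop) (by fun_prop) (fun t => (hpos t).ne')
  have h0 : h 0 = 0 := by simp [h]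
  let g : ℝ → ℝ := fun t => t * h t
  have hgcont : Continuous g := continuous_id.mul hcont
  have hg0 : g 0 = 0 := by simp [g]
  have hg01 : ∀ t, 0 ≤ g t ∧ g t ≤ 1 := by
    intro t
    have : g t = t ^ 2 / (t ^ 2 + δ) := by simp only [g, h]; ring
    rw [this]
    exact ⟨by positivity, by rw [div_le_one (hpos t)]; linarith⟩
  have hemul : c * cfcₙ h c = cfcₙ g c := by
    have := cfcₙ_mul (fun t : ℝ => t) h c (by fun_prop) rfl hcont.continuousOn h0
    rw [cfcₙ_id' ℝ c] at this
    exact this.symm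
  have hesa : IsSelfAdjoint (cfcₙ g c) := cfcₙ_predicate g c
  have hnorm : ‖cfcₙ g c‖ ≤ 1 := by
    refine norm_cfcₙ_le (fun t _ => ?_)
    rw [Real.norm_eq_abs, abs_of_nonneg (hg01 t).1]
    exact (hg01 t).2
  refine ⟨cfcₙ g c, ?_, hesa, hnorm, ?_, ?_⟩
  · rw [← hemul]
    exact I.mul_mem_right' _ hc
  · intro x
    let _ : PartialOrder A := CStarAlgebra.spectralOrder A
    have : StarOrderedRing A := CStarAlgebra.spectralOrderedRing A
    let _ : PartialOrder (Unitization ℂ A) := CStarAlgebra.spectralOrder _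
    have : StarOrderedRing (Unitization ℂ A) := CStarAlgebra.spectralOrderedRing _
    have he0 : 0 ≤ cfcₙ g c := cfcₙ_nonneg (fun t _ => (hg01 t).1)
    have he0' : (0 : Unitization ℂ A) ≤ (cfcₙ g c : A) := Unitization.inr_nonneg_iff.2 he0
    have he1 : ((cfcₙ g c : A) : Unitization ℂ A) ≤ 1 := by
      rw [← CStarAlgebra.norm_le_one_iff_of_nonneg _ he0', Unitization.norm_inr]
      exact hnorm
    have h1 : ‖(1 : Unitization ℂ A) - (cfcₙ g c : A)‖ ≤ 1 := by
      rw [CStarAlgebra.norm_le_one_iff_of_nonneg _ (sub_nonneg.2 he1)]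
      exact sub_le_self _ he0'
    calc ‖x - x * cfcₙ g c‖ = ‖((x - x * cfcₙ g c : A) : Unitization ℂ A)‖ :=
          (Unitization.norm_inr _).symm
      _ = ‖(x : Unitization ℂ A) * (1 - (cfcₙ g c : A))‖ := by
          rw [mul_sub, mul_one, Unitization.inr_sub, Unitization.inr_mul]
      _ ≤ ‖(x : Unitization ℂ A)‖ * 1 := (norm_mul_le _ _).trans (by gcongr)
      _ = ‖x‖ := by rw [mul_one, Unitization.norm_inr]
  · have : c - c * cfcₙ g c = cfcₙ (fun t => t - t * g t) c := by
      rw [cfcₙ_sub (fun t : ℝ => t) (fun t => t * g t) c (by fun_prop) rfl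
        (by fun_prop) (by simp [hg0]),
        cfcₙ_mul (fun t : ℝ => t) g c (by fun_prop) rfl (by fun_prop) hg0, cfcₙ_id' ℝ c]
    rw [this]
    refine lt_of_le_of_lt (norm_cfcₙ_le (c := ε / 2) (fun t _ => ?_)) (by linarith)
    have : t - t * g t = t * ε ^ 2 / (t ^ 2 + ε ^ 2) := by
      have := (hpos t).ne'
      simp only [g, h, hδ] at *
      field_simp
      ring
    rw [this, Real.norm_eq_abs, abs_div, abs_mul, abs_of_pos (hpos t), abs_of_pos hδ0,
      div_le_iff₀ (hpos t)]
    nlinarith [sq_nonneg (|t| - ε), sq_abs t, abs_nonneg t]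

theorem star_mem (I : ClosedIdeal A) {a : A} (ha : a ∈ I.toSubmodule) :
    star a ∈ I.toSubmodule := by
  have hcl : IsClosed (I.toSubmodule : Set A) := I.isClosed'
  change star a ∈ (I.toSubmodule : Set A)
  rw [← hcl.closure_eq, Metric.mem_closure_iff]
  intro ε hε
  obtain ⟨e, he, hes, hen, -, hce⟩ := I.exists_local_unit (I.mul_mem_right' (star a) ha)
    (by simp) (ε := ε ^ 2 / 2) (by positivity)
  refine ⟨star a * e, I.mul_mem_left' _ he, ?_⟩
  rw [dist_eq_norm]
  have h1 : ‖star a - star a * e‖ * ‖star a - star a * e‖ < ε * ε := by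
    rw [← CStarRing.norm_star_mul_self]
    have : star (star a - star a * e) * (star a - star a * e)
        = (a * star a - a * star a * e) - e * (a * star a - a * star a * e) := by
      simp only [star_sub, star_mul, star_star, hes]
      noncomm_ring
    rw [this]
    calc _ ≤ ‖a * star a - a * star a * e‖ + ‖e‖ * ‖a * star a - a * star a * e‖ :=
          (norm_sub_le _ _).trans (by gcongr; exact norm_mul_le _ _)
      _ ≤ ‖a * star a - a * star a * e‖ + 1 * ‖a * star a - a * star a * e‖ := by gcongr
      _ < ε * ε := by nlinarith
  exact lt_of_mul_self_lt_mul_self₀ hε.le h1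

theorem exists_approx (I : ClosedIdeal A) (a : A) {ε : ℝ} (hε : 0 < ε) :
    ∃ e ∈ I.toSubmodule, star e = e ∧ ‖(a - a * e) - e * (a - a * e)‖ <
      ‖(Submodule.Quotient.mk a : A ⧸ I.toSubmodule)‖ + ε := by
  obtain ⟨b, hb, hlt⟩ := Submodule.Quotient.norm_mk_lt
    (Submodule.Quotient.mk a : A ⧸ I.toSubmodule) (ε := ε / 2) (by positivity)
  have hi : b - a ∈ I.toSubmodule := (Submodule.Quotient.eq _).1 hb
  set i := b - a with hidef
  obtain ⟨e, he, hes, hen, hctr, hce⟩ := I.exists_local_unit (I.mul_mem_left' (star i) hi)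
    (by simp) (ε := (ε / 2) ^ 2 / 2) (by positivity)
  have hsmall : ‖i - i * e‖ < ε / 2 := by
    refine lt_of_mul_self_lt_mul_self₀ (by positivity) ?_
    rw [← CStarRing.norm_star_mul_self]
    have : star (i - i * e) * (i - i * e)
        = (star i * i - star i * i * e) - e * (star i * i - star i * i * e) := by
      simp only [star_sub, star_mul, hes]
      noncomm_ring
    rw [this]
    calc _ ≤ ‖star i * i - star i * i * e‖ + ‖e‖ * ‖star i * i - star i * i * e‖ :=
          (norm_sub_le _ _).trans (by gcongr; exact norm_mul_le _ _)
      _ ≤ ‖star i * i - star i * i * e‖ + 1 * ‖star i * i - star i * i * e‖ := by gcongr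
      _ < ε / 2 * (ε / 2) := by nlinarith
  have hl : ∀ y : A, ‖y - e * y‖ ≤ ‖y‖ := by
    intro y
    have := hctr (star y)
    rwa [← norm_star, norm_star y, star_sub, star_mul, star_star, hes] at this
  refine ⟨e, he, hes, (hl _).trans_lt ?_⟩
  have : a - a * e = (b - b * e) - (i - i * e) := by rw [hidef]; noncomm_ring
  rw [this]
  calc _ ≤ ‖b - b * e‖ + ‖i - i * e‖ := norm_sub_le _ _
    _ ≤ ‖b‖ + ‖i - i * e‖ := by gcongr; exact hctr b
    _ < _ := by linarith
end ClosedIdeal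

/-! ### The C⋆-algebra generated by a family of bounded functions -/

section Universal
open scoped ENNReal
variable {G : Type*} {ι : Type*} {B : ι → Type*} [∀ i, NonUnitalCStarAlgebra (B i)]
  (f : ∀ i, G → B i) (hf : ∀ g, ∃ C : ℝ, ∀ i, ‖f i g‖ ≤ C)

/-- The element `(f i g)ᵢ` of the `ℓ^∞`-product of the C⋆-algebras `B i`. -/
def univGen (g : G) : lp B ∞ :=
  ⟨fun i => f i g, memℓp_infty (by
    obtain ⟨C, hC⟩ := hf g
    exact ⟨C, by rintro _ ⟨i, rfl⟩; exact hC i⟩)⟩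

/-- The closed ⋆-subalgebra of the `ℓ^∞`-product of the `B i` generated by the elements
`(f i g)ᵢ`. If `i` runs through all representations, in C⋆-algebras, of a set `G` of generators
subject to given relations, this is the universal C⋆-algebra of these generators and relations. -/
noncomputable def univAlg : NonUnitalStarSubalgebra ℂ (lp B ∞) :=
  (NonUnitalStarAlgebra.adjoin ℂ (Set.range (univGen f hf))).topologicalClosure

theorem univGen_mem (g : G) : univGen f hf g ∈ univAlg f hf :=
  NonUnitalStarSubalgebra.le_topologicalClosure _
    (NonUnitalStarAlgebra.subset_adjoin ℂ _ ⟨g, rfl⟩)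

noncomputable instance univAlg.instCStar : NonUnitalCStarAlgebra (univAlg f hf) :=
  NonUnitalStarSubalgebra.nonUnitalCStarAlgebra _
    (h_closed := NonUnitalStarSubalgebra.isClosed_topologicalClosure _)

/-- The representation of the universal algebra that corresponds to the index `i`. -/
def univEval (i : ι) : univAlg f hf →⋆ₙₐ[ℂ] B i where
  toFun x := (x : lp B ∞) i
  map_smul' _ _ := rfl
  map_zero' := rfl
  map_add' _ _ := rfl
  map_mul' _ _ := rfl
  map_star' _ := rfl

theorem univAlg_hom_ext {C : Type*} [NonUnitalCStarAlgebra C] {Φ Ψ : univAlg f hf →⋆ₙₐ[ℂ] C}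
    (h : ∀ g, Φ ⟨univGen f hf g, univGen_mem f hf g⟩ = Ψ ⟨univGen f hf g, univGen_mem f hf g⟩) :
    Φ = Ψ := by
  have hΦ : Continuous Φ := AddMonoidHomClass.continuous_of_bound Φ 1
    (fun x => by simpa using NonUnitalStarAlgHom.norm_apply_le Φ x)
  have hΨ : Continuous Ψ := AddMonoidHomClass.continuous_of_bound Ψ 1
    (fun x => by simpa using NonUnitalStarAlgHom.norm_apply_le Ψ x)
  have key : ∀ x (hx : x ∈ NonUnitalStarAlgebra.adjoin ℂ (Set.range (univGen f hf))),
      Φ ⟨x, NonUnitalStarSubalgebra.le_topologicalClosure _ hx⟩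
        = Ψ ⟨x, NonUnitalStarSubalgebra.le_topologicalClosure _ hx⟩ := by
    intro x hx
    induction hx using NonUnitalStarAlgebra.adjoin_induction with
    | mem x hx => obtain ⟨g, rfl⟩ := hx; exact h g
    | add x y hx hy h1 h2 =>
      exact (map_add Φ ⟨x, _⟩ ⟨y, _⟩).trans
        ((congrArg₂ (· + ·) h1 h2).trans (map_add Ψ ⟨x, _⟩ ⟨y, _⟩).symm)
    | zero => exact (map_zero Φ).trans (map_zero Ψ).symm
    | mul x y hx hy h1 h2 =>
      exact (map_mul Φ ⟨x, _⟩ ⟨y, _⟩).trans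
        ((congrArg₂ (· * ·) h1 h2).trans (map_mul Ψ ⟨x, _⟩ ⟨y, _⟩).symm)
    | smul r x hx h1 =>
      exact (map_smul Φ r ⟨x, _⟩).trans
        ((congrArg (r • ·) h1).trans (map_smul Ψ r ⟨x, _⟩).symm)
    | star x hx h1 =>
      exact (map_star Φ ⟨x, _⟩).trans
        ((congrArg star h1).trans (map_star Ψ ⟨x, _⟩).symm)
  have hd : Dense {z : univAlg f hf |
      (z : lp B ∞) ∈ NonUnitalStarAlgebra.adjoin ℂ (Set.range (univGen f hf))} := by
    intro z
    rw [closure_subtype]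
    have hz := z.2
    refine closure_mono ?_ hz
    intro y hy
    exact ⟨⟨y, NonUnitalStarSubalgebra.le_topologicalClosure _ hy⟩, hy, rfl⟩
  refine DFunLike.coe_injective (Continuous.ext_on hd hΦ hΨ ?_)
  rintro ⟨z, hz'⟩ hz
  exact key z hz
end Universal

/-! ### Ideals and quotients of C⋆-algebras -/

theorem norm_le_mul_of_quotient {M N P : Type*} [SeminormedAddCommGroup M]
    [SeminormedAddCommGroup N] [SeminormedAddCommGroup P] [Module ℂ M] [Module ℂ N]
    {S : Submodule ℂ M} {S' : Submodule ℂ N} (x : M ⧸ S) (y : N ⧸ S') (z : P)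
    (H : ∀ m n, Submodule.Quotient.mk m = x → Submodule.Quotient.mk n = y → ‖z‖ ≤ ‖m‖ * ‖n‖) :
    ‖z‖ ≤ ‖x‖ * ‖y‖ := by
  have ht : Filter.Tendsto (fun δ : ℝ => (‖x‖ + δ) * (‖y‖ + δ)) (nhdsWithin 0 (Set.Ioi 0))
      (nhds (‖x‖ * ‖y‖)) := by
    have : Continuous (fun δ : ℝ => (‖x‖ + δ) * (‖y‖ + δ)) := by fun_prop
    have h := this.tendsto 0
    simp only [add_zero] at h
    exact h.mono_left nhdsWithin_le_nhds
  refine ge_of_tendsto ht ?_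
  filter_upwards [self_mem_nhdsWithin] with δ hδ
  obtain ⟨m, hm, hm'⟩ := Submodule.Quotient.norm_mk_lt x hδ
  obtain ⟨n, hn, hn'⟩ := Submodule.Quotient.norm_mk_lt y hδ
  have h0 : 0 ≤ ‖x‖ + δ := (norm_nonneg m).trans hm'.le
  exact (H m n hm hn).trans (by gcongr)

namespace ClosedIdeal
variable {A : Type u} [NonUnitalCStarAlgebra A]

/-- The zero ideal. -/
def zero (A : Type u) [NonUnitalCStarAlgebra A] : ClosedIdeal A where
  toSubmodule := ⊥
  mul_mem_left' a b hb := by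
    have : b = 0 := hb
    subst this
    exact mul_zero a
  mul_mem_right' a b hb := by
    have : b = 0 := hb
    subst this
    exact zero_mul a
  isClosed' := isClosed_singleton

/-- The intersection of two ideals. -/
def inter (I J : ClosedIdeal A) : ClosedIdeal A where
  toSubmodule := I.toSubmodule ⊓ J.toSubmodule
  mul_mem_left' a _ hb := ⟨I.mul_mem_left' a hb.1, J.mul_mem_left' a hb.2⟩
  mul_mem_right' a _ hb := ⟨I.mul_mem_right' a hb.1, J.mul_mem_right' a hb.2⟩
  isClosed' := I.isClosed'.inter J.isClosed'

/-- The closed linear span of a sequence of ideals. -/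
def closedSum (S : ℕ → ClosedIdeal A) : ClosedIdeal A where
  toSubmodule := (⨆ k, (S k).toSubmodule).topologicalClosure
  mul_mem_left' a b hb := by
    have h1 : ∀ b ∈ ⨆ k, (S k).toSubmodule, a * b ∈ ⨆ k, (S k).toSubmodule := by
      intro b hb
      refine Submodule.iSup_induction _ (motive := fun b => a * b ∈ ⨆ k, (S k).toSubmodule) hb
        (fun k x hx => Submodule.mem_iSup_of_mem k ((S k).mul_mem_left' a hx)) (by simp) ?_
      intro x y hx hy
      rw [mul_add]
      exact add_mem hx hy
    exact map_mem_closure (continuous_const_mul a) hb h1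
  mul_mem_right' a b hb := by
    have h1 : ∀ b ∈ ⨆ k, (S k).toSubmodule, b * a ∈ ⨆ k, (S k).toSubmodule := by
      intro b hb
      refine Submodule.iSup_induction _ (motive := fun b => b * a ∈ ⨆ k, (S k).toSubmodule) hb
        (fun k x hx => Submodule.mem_iSup_of_mem k ((S k).mul_mem_right' a hx)) (by simp) ?_
      intro x y hx hy
      rw [add_mul]
      exact add_mem hx hy
    exact map_mem_closure (f := fun b => b * a) (continuous_mul_const a) hb h1
  isClosed' := Submodule.isClosed_topologicalClosure _

/-- The annihilator `I^⊥ = {a | a I = 0}` of an ideal, as a subspace. -/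
def annihilator (I : Submodule ℂ A) : Submodule ℂ A where
  carrier := {a | ∀ b ∈ I, a * b = 0}
  add_mem' ha hb c hc := by rw [add_mul, ha c hc, hb c hc, add_zero]
  zero_mem' c _ := zero_mul c
  smul_mem' r a ha c hc := by rw [smul_mul_assoc, ha c hc, smul_zero]

/-- The quotient C⋆-algebra `A / I`, with the quotient norm. -/
def Quotient (I : ClosedIdeal A) : Type u := A ⧸ I.toSubmodule

variable (I : ClosedIdeal A)

/-- The quotient map `A → A / I`. -/
def proj (a : A) : I.Quotient := Submodule.Quotient.mk a

noncomputable instance : NormedAddCommGroup I.Quotient :=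
  haveI : IsClosed (I.toSubmodule : Set A) := I.isClosed'
  inferInstanceAs (NormedAddCommGroup (A ⧸ I.toSubmodule))

noncomputable instance : NormedSpace ℂ I.Quotient :=
  inferInstanceAs (NormedSpace ℂ (A ⧸ I.toSubmodule))

instance : CompleteSpace I.Quotient :=
  inferInstanceAs (CompleteSpace (A ⧸ I.toSubmodule))

theorem proj_surjective : Function.Surjective I.proj := Submodule.Quotient.mk_surjective _

theorem proj_eq_proj {a b : A} : I.proj a = I.proj b ↔ a - b ∈ I.toSubmodule := Submodule.Quotient.eq _

theorem norm_proj_le (a : A) : ‖I.proj a‖ ≤ ‖a‖ := Submodule.Quotient.norm_mk_le _ a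

theorem proj_add (a b : A) : I.proj (a + b) = I.proj a + I.proj b := rfl

theorem proj_smul (r : ℂ) (a : A) : I.proj (r • a) = r • I.proj a := rfl


/-- Multiplication of `A / I`, as a bilinear map. -/
noncomputable def mulQ : I.Quotient →ₗ[ℂ] I.Quotient →ₗ[ℂ] I.Quotient :=
  I.toSubmodule.liftQ
    { toFun := fun a => I.toSubmodule.mapQ I.toSubmodule (LinearMap.mulLeft ℂ a)
        (fun _ hb => I.mul_mem_left' a hb)
      map_add' := fun a b => by
        refine Submodule.linearMap_qext _ (LinearMap.ext fun c => ?_)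
        exact congrArg I.proj (add_mul a b c)
      map_smul' := fun r a => by
        refine Submodule.linearMap_qext _ (LinearMap.ext fun c => ?_)
        exact congrArg I.proj (smul_mul_assoc r a c) }
    (fun a ha => by
      refine Submodule.linearMap_qext _ (LinearMap.ext fun c => ?_)
      exact (Submodule.Quotient.mk_eq_zero _).2 (I.mul_mem_right' c ha))

/-- The involution of `A / I`, as a conjugate-linear map. -/
noncomputable def starQ : I.Quotient →ₗ⋆[ℂ] I.Quotient :=
  I.toSubmodule.mapQ I.toSubmodule (starₗᵢ ℂ : A ≃ₗᵢ⋆[ℂ] A).toLinearEquiv.toLinearMap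
    (fun _ ha => I.star_mem ha)

noncomputable instance : Mul I.Quotient := ⟨fun x y => I.mulQ x y⟩

noncomputable instance : Star I.Quotient := ⟨fun x => I.starQ x⟩

theorem proj_mul (a b : A) : I.proj (a * b) = I.proj a * I.proj b := rfl

theorem proj_star (a : A) : I.proj (star a) = star (I.proj a) := rfl

theorem norm_star_le_quotient (x : I.Quotient) : ‖star x‖ ≤ ‖x‖ := by
  refine le_of_forall_pos_le_add fun ε hε => ?_
  obtain ⟨a, rfl, ha⟩ := Submodule.Quotient.norm_mk_lt x hε
  calc ‖I.proj (star a)‖ ≤ ‖star a‖ := I.norm_proj_le _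
    _ = ‖a‖ := norm_star a
    _ ≤ _ := ha.le

noncomputable instance instQuotientCStar : NonUnitalCStarAlgebra I.Quotient where
  left_distrib x y z := map_add (I.mulQ x) y z
  right_distrib x y z := congrArg (fun L => L z) (map_add I.mulQ x y)
  zero_mul x := congrArg (fun L => L x) (map_zero I.mulQ)
  mul_zero x := map_zero (I.mulQ x)
  mul_assoc x y z := by
    obtain ⟨a, rfl⟩ := I.proj_surjective x
    obtain ⟨b, rfl⟩ := I.proj_surjective y
    obtain ⟨c, rfl⟩ := I.proj_surjective z
    exact congrArg I.proj (mul_assoc a b c)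
  dist_eq := dist_eq_norm_neg_add
  norm_mul_le x y := by
    refine norm_le_mul_of_quotient x y _ ?_
    rintro m n rfl rfl
    exact (I.norm_proj_le (m * n)).trans (norm_mul_le m n)
  star_involutive x := by
    obtain ⟨a, rfl⟩ := I.proj_surjective x
    exact congrArg I.proj (star_star a)
  star_mul x y := by
    obtain ⟨a, rfl⟩ := I.proj_surjective x
    obtain ⟨b, rfl⟩ := I.proj_surjective y
    exact congrArg I.proj (star_mul a b)
  star_add x y := map_add I.starQ x y
  norm_mul_self_le x := by
    obtain ⟨a, rfl⟩ := I.proj_surjective x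
    refine le_of_forall_pos_le_add fun ε hε => ?_
    obtain ⟨e, he, hes, hlt⟩ := I.exists_approx (star a * a) hε
    have h1 : I.proj a = I.proj (a - a * e) := by
      rw [I.proj_eq_proj, sub_sub_cancel]
      exact I.mul_mem_left' a he
    have h2 : star (a - a * e) * (a - a * e)
        = (star a * a - star a * a * e) - e * (star a * a - star a * a * e) := by
      simp only [star_sub, star_mul, hes]
      noncomm_ring
    calc ‖I.proj a‖ * ‖I.proj a‖ ≤ ‖a - a * e‖ * ‖a - a * e‖ := by
          rw [h1]; gcongr <;> exact I.norm_proj_le _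
      _ = ‖(star a * a - star a * a * e) - e * (star a * a - star a * a * e)‖ := by
          rw [← CStarRing.norm_star_mul_self, h2]
      _ ≤ ‖I.proj (star a * a)‖ + ε := hlt.le
      _ = _ := rfl
  smul_zero := smul_zero
  smul_add := smul_add
  add_smul := add_smul
  zero_smul := zero_smul ℂ
  norm_smul_le := norm_smul_le
  smul_assoc r x y := congrArg (fun L => L y) (map_smul I.mulQ r x)
  smul_comm r x y := (map_smul (I.mulQ x) r y).symm
  star_smul r x := I.starQ.map_smulₛₗ r x

end ClosedIdeal

/-! ### Right tensor C⋆-precategories -/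

/-- A right tensor C⋆-precategory: its objects are the natural numbers, `Hom n m` is the Banach
space of morphisms from `n` to `m`, composition is bilinear and contractive, the involution
`adj` satisfies the C⋆-equality, and `tensor` is the endomorphism `a ↦ a ⊗ 1`, which sends the
object `n` to `n + 1`. There need not be identity morphisms. -/
structure RightTensorCStarPrecategory where
  Hom : ℕ → ℕ → Type u
  [instNormed : ∀ n m, NormedAddCommGroup (Hom n m)]
  [instSpace : ∀ n m, NormedSpace ℂ (Hom n m)]
  [instComplete : ∀ n m, CompleteSpace (Hom n m)]
  comp : ∀ {n m k : ℕ}, Hom m k →ₗ[ℂ] Hom n m →ₗ[ℂ] Hom n k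
  comp_assoc : ∀ {n m k l : ℕ} (a : Hom k l) (b : Hom m k) (c : Hom n m),
    comp (comp a b) c = comp a (comp b c)
  norm_comp_le : ∀ {n m k : ℕ} (a : Hom m k) (b : Hom n m), ‖comp a b‖ ≤ ‖a‖ * ‖b‖
  adj : ∀ {n m : ℕ}, Hom n m →ₗ⋆[ℂ] Hom m n
  adj_adj : ∀ {n m : ℕ} (a : Hom n m), adj (adj a) = a
  adj_comp : ∀ {n m k : ℕ} (a : Hom m k) (b : Hom n m), adj (comp a b) = comp (adj b) (adj a)
  norm_adj_comp_self : ∀ {n m : ℕ} (a : Hom n m), ‖comp (adj a) a‖ = ‖a‖ ^ 2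
  tensor : ∀ {n m : ℕ}, Hom n m →ₗ[ℂ] Hom (n + 1) (m + 1)
  tensor_comp : ∀ {n m k : ℕ} (a : Hom m k) (b : Hom n m),
    tensor (comp a b) = comp (tensor a) (tensor b)
  tensor_adj : ∀ {n m : ℕ} (a : Hom n m), tensor (adj a) = adj (tensor a)

namespace RightTensorCStarPrecategory

attribute [instance] instNormed instSpace instComplete

variable (T : RightTensorCStarPrecategory.{u})

/-- `T` is a right tensor C⋆-category if every object has an identity morphism. -/
def IsCategory : Prop :=
  ∀ n, ∃ e : T.Hom n n, (∀ m (a : T.Hom n m), T.comp a e = a) ∧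
    ∀ m (a : T.Hom m n), T.comp e a = a

variable {T}

/-- The iterated right tensoring `a ↦ a ⊗ 1^k`. -/
def tensorIter {n m : ℕ} : (k : ℕ) → T.Hom n m → T.Hom (n + k) (m + k)
  | 0, a => a
  | k + 1, a => T.tensor (tensorIter k a)

theorem norm_adj {n m : ℕ} (a : T.Hom n m) : ‖T.adj a‖ = ‖a‖ := by
  have key : ∀ {n m : ℕ} (a : T.Hom n m), ‖a‖ ≤ ‖T.adj a‖ := by
    intro n m a
    have h := T.norm_adj_comp_self a
    have h2 := T.norm_comp_le (T.adj a) a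
    rw [h, sq] at h2
    rcases (norm_nonneg a).eq_or_lt with h0 | h0
    · rw [← h0]; exact norm_nonneg _
    · exact le_of_mul_le_mul_right h2 h0
  refine le_antisymm ?_ (key a)
  simpa only [T.adj_adj] using key (T.adj a)

/-- The C⋆-algebra `T(n,n)`. -/
noncomputable instance instHomCStar (n : ℕ) : NonUnitalCStarAlgebra (T.Hom n n) where
  mul a b := T.comp a b
  star a := T.adj a
  left_distrib a b c := map_add (T.comp a) b c
  right_distrib a b c := congrArg (fun L : T.Hom n n →ₗ[ℂ] T.Hom n n => L c) (map_add T.comp a b)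
  zero_mul a := congrArg (fun L : T.Hom n n →ₗ[ℂ] T.Hom n n => L a) (map_zero T.comp)
  mul_zero a := map_zero (T.comp a)
  mul_assoc a b c := T.comp_assoc a b c
  dist_eq := dist_eq_norm_neg_add
  norm_mul_le a b := T.norm_comp_le a b
  star_involutive a := T.adj_adj a
  star_mul a b := T.adj_comp a b
  star_add a b := map_add T.adj a b
  norm_mul_self_le a := by
    have := T.norm_adj_comp_self a
    rw [sq] at this
    exact this.ge
  smul_zero := smul_zero
  smul_add := smul_add
  add_smul := add_smul
  zero_smul := zero_smul ℂ
  norm_smul_le := norm_smul_le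
  smul_assoc r a b := congrArg (fun L : T.Hom n n →ₗ[ℂ] T.Hom n n => L b) (map_smul T.comp r a)
  smul_comm r a b := (map_smul (T.comp a) r b).symm
  star_smul r a := T.adj.map_smulₛₗ r a

theorem norm_tensor_le {n m : ℕ} (a : T.Hom n m) : ‖T.tensor a‖ ≤ ‖a‖ := by
  let φ : T.Hom n n →⋆ₙₐ[ℂ] T.Hom (n + 1) (n + 1) :=
    { toFun := fun b => T.tensor b
      map_smul' := fun r b => map_smul T.tensor r b
      map_zero' := map_zero T.tensor
      map_add' := map_add T.tensor
      map_mul' := fun b c => T.tensor_comp b c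
      map_star' := fun b => T.tensor_adj b }
  have h : ‖T.tensor (T.comp (T.adj a) a)‖ ≤ ‖T.comp (T.adj a) a‖ :=
    NonUnitalStarAlgHom.norm_apply_le φ (T.comp (T.adj a) a)
  rw [T.tensor_comp, T.tensor_adj, T.norm_adj_comp_self, T.norm_adj_comp_self] at h
  exact le_of_sq_le_sq h (norm_nonneg _)

theorem continuous_tensor {n m : ℕ} : Continuous (T.tensor : T.Hom n m → T.Hom (n + 1) (m + 1)) :=
  AddMonoidHomClass.continuous_of_bound T.tensor 1 (fun a => by simpa using norm_tensor_le a)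

theorem continuous_comp_left {n m k : ℕ} (a : T.Hom m k) :
    Continuous (fun b : T.Hom n m => T.comp a b) :=
  AddMonoidHomClass.continuous_of_bound (T.comp a) ‖a‖ (fun b => T.norm_comp_le a b)

theorem continuous_comp_right {n m k : ℕ} (b : T.Hom n m) :
    Continuous (fun a : T.Hom m k => T.comp a b) :=
  AddMonoidHomClass.continuous_of_bound ((T.comp (k := k)).flip b) ‖b‖ (fun a => by
    rw [mul_comm]; exact T.norm_comp_le a b)

/-- A closed two-sided ideal in (the C⋆-precategory underlying) `T`. -/
structure CatIdeal (T : RightTensorCStarPrecategory.{u}) where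
  mor : ∀ n m : ℕ, Submodule ℂ (T.Hom n m)
  isClosed_mor : ∀ n m, IsClosed (mor n m : Set (T.Hom n m))
  comp_mem_left : ∀ {n m k : ℕ} (a : T.Hom m k) {b : T.Hom n m}, b ∈ mor n m → T.comp a b ∈ mor n k
  comp_mem_right : ∀ {n m k : ℕ} {a : T.Hom m k} (b : T.Hom n m), a ∈ mor m k → T.comp a b ∈ mor n k

namespace CatIdeal

instance : LE (CatIdeal T) := ⟨fun K L => ∀ n m, K.mor n m ≤ L.mor n m⟩

/-- The diagonal ideal `K(n,n)` in the C⋆-algebra `T(n,n)`. -/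
def diag (K : CatIdeal T) (n : ℕ) : ClosedIdeal (T.Hom n n) where
  toSubmodule := K.mor n n
  mul_mem_left' a _ hb := K.comp_mem_left a hb
  mul_mem_right' a _ hb := K.comp_mem_right a hb
  isClosed' := K.isClosed_mor n n

theorem adj_mem (K : CatIdeal T) {n m : ℕ} {a : T.Hom n m} (ha : a ∈ K.mor n m) :
    T.adj a ∈ K.mor m n := by
  change T.adj a ∈ (K.mor m n : Set (T.Hom m n))
  rw [← (K.isClosed_mor m n).closure_eq, Metric.mem_closure_iff]
  intro ε hε
  have hc : T.comp a (T.adj a) ∈ K.mor m m := K.comp_mem_right _ ha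
  obtain ⟨e, he, hes, hen, -, hce⟩ := (K.diag m).exists_local_unit hc
    (by change T.adj (T.comp a (T.adj a)) = _; rw [T.adj_comp, T.adj_adj])
    (ε := ε ^ 2 / 2) (by positivity)
  refine ⟨T.comp (T.adj a) e, K.comp_mem_left _ he, ?_⟩
  rw [dist_eq_norm]
  have hes' : T.adj e = e := hes
  set c := T.comp a (T.adj a) with hcdef
  have h1 : ‖T.adj a - T.comp (T.adj a) e‖ ^ 2 < ε ^ 2 := by
    rw [← T.norm_adj_comp_self]
    have : T.comp (T.adj (T.adj a - T.comp (T.adj a) e)) (T.adj a - T.comp (T.adj a) e)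
        = (c - c * e) - e * (c - c * e) := by
      change _ = (c - T.comp c e) - T.comp e (c - T.comp c e)
      simp only [map_sub, T.adj_comp, T.adj_adj, hes', LinearMap.sub_apply, hcdef, T.comp_assoc]
      abel
    rw [this]
    calc _ ≤ ‖c - c * e‖ + ‖e‖ * ‖c - c * e‖ :=
          (norm_sub_le _ _).trans (by gcongr; exact norm_mul_le _ _)
      _ ≤ ‖c - c * e‖ + 1 * ‖c - c * e‖ := by gcongr
      _ < ε ^ 2 := by linarith
  exact lt_of_pow_lt_pow_left₀ 2 hε.le h1

/-- The zero ideal. -/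
def zero (T : RightTensorCStarPrecategory.{u}) : CatIdeal T where
  mor _ _ := ⊥
  isClosed_mor _ _ := isClosed_singleton
  comp_mem_left a b hb := by
    have : b = 0 := hb
    subst this
    exact map_zero (T.comp a)
  comp_mem_right {n m k a} b hb := by
    have : a = 0 := hb
    subst this
    exact congrArg (fun L : T.Hom n m →ₗ[ℂ] T.Hom n k => L b) (map_zero T.comp)

/-- The intersection of two ideals. -/
def inter (K L : CatIdeal T) : CatIdeal T where
  mor n m := K.mor n m ⊓ L.mor n m
  isClosed_mor n m := (K.isClosed_mor n m).inter (L.isClosed_mor n m)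
  comp_mem_left a _ hb := ⟨K.comp_mem_left a hb.1, L.comp_mem_left a hb.2⟩
  comp_mem_right b ha := ⟨K.comp_mem_right b ha.1, L.comp_mem_right b ha.2⟩

/-- The preimage `(⊗1)⁻¹(K)`. -/
def tensorPreimage (K : CatIdeal T) : CatIdeal T where
  mor n m := (K.mor (n + 1) (m + 1)).comap T.tensor
  isClosed_mor n m := (K.isClosed_mor (n + 1) (m + 1)).preimage continuous_tensor
  comp_mem_left a b hb := by
    rw [Submodule.mem_comap, T.tensor_comp]
    exact K.comp_mem_left _ hb
  comp_mem_right b ha := by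
    rw [Submodule.mem_comap, T.tensor_comp]
    exact K.comp_mem_right _ ha

/-- The ideal `J(K) = (⊗1)⁻¹(K) ∩ K`. -/
def coisometryDomain (K : CatIdeal T) : CatIdeal T := K.tensorPreimage.inter K

/-- The kernel of the endomorphism `⊗1`. -/
def kerTensor (T : RightTensorCStarPrecategory.{u}) : CatIdeal T := (zero T).tensorPreimage

/-- The annihilator of an ideal `K`: the morphisms `a` with `a b = 0` for all composable `b` in
`K`. By `mem_annihilator_diag` its diagonal spaces are the annihilators of the ideals `K(n,n)`
in the C⋆-algebras `T(n,n)`. -/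
def annihilator (K : CatIdeal T) : CatIdeal T where
  mor n m :=
    { carrier := {a | ∀ k, ∀ b ∈ K.mor k n, T.comp a b = 0}
      add_mem' := fun ha hb k c hc => by
        rw [map_add, LinearMap.add_apply, ha k c hc, hb k c hc, add_zero]
      zero_mem' := fun k c _ => by rw [map_zero, LinearMap.zero_apply]
      smul_mem' := fun r a ha k c hc => by
        rw [map_smul, LinearMap.smul_apply, ha k c hc, smul_zero] }
  isClosed_mor n m := by
    have : {a : T.Hom n m | ∀ k, ∀ b ∈ K.mor k n, T.comp a b = 0}
        = ⋂ k, ⋂ b ∈ K.mor k n, {a : T.Hom n m | T.comp a b = 0} := by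
      ext a; simp
    change IsClosed {a : T.Hom n m | ∀ k, ∀ b ∈ K.mor k n, T.comp a b = 0}
    rw [this]
    exact isClosed_iInter fun k => isClosed_biInter fun b _ =>
      isClosed_eq (continuous_comp_right b) continuous_const
  comp_mem_left a b hb k c hc := by rw [T.comp_assoc, hb k c hc, map_zero]
  comp_mem_right b ha k c hc := by
    rw [T.comp_assoc]
    exact ha k _ (K.comp_mem_left b hc)

theorem mem_annihilator_diag (K : CatIdeal T) {n : ℕ} (a : T.Hom n n) :
    a ∈ K.annihilator.mor n n ↔ a ∈ ClosedIdeal.annihilator (K.mor n n) := by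
  refine ⟨fun h b hb => h n b hb, fun h k b hb => ?_⟩
  have h1 : T.comp a (T.comp b (T.adj b)) = 0 := h _ (K.comp_mem_right _ hb)
  have h2 : T.comp (T.comp a b) (T.adj (T.comp a b)) = 0 := by
    rw [T.adj_comp, ← T.comp_assoc, T.comp_assoc a, h1, map_zero, LinearMap.zero_apply]
  have h3 := T.norm_adj_comp_self (T.adj (T.comp a b))
  rw [T.adj_adj, h2, norm_zero, norm_adj] at h3
  exact norm_eq_zero.1 (pow_eq_zero_iff two_ne_zero |>.1 h3.symm)

/-- The ideal `∑ₖ Sₖ`, whose spaces of morphisms are the closed linear spans of the `Sₖ(n,m)`. -/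
def closedSum (S : ℕ → CatIdeal T) : CatIdeal T where
  mor n m := (⨆ k, (S k).mor n m).topologicalClosure
  isClosed_mor n m := Submodule.isClosed_topologicalClosure _
  comp_mem_left {n m l} a b hb := by
    have h1 : ∀ b ∈ ⨆ k, (S k).mor n m, T.comp a b ∈ ⨆ k, (S k).mor n l := by
      intro b hb
      refine Submodule.iSup_induction _ (motive := fun b => T.comp a b ∈ ⨆ k, (S k).mor n l) hb
        (fun k x hx => Submodule.mem_iSup_of_mem k ((S k).comp_mem_left a hx)) (by simp) ?_
      intro x y hx hy
      rw [map_add]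
      exact add_mem hx hy
    exact map_mem_closure (continuous_comp_left a) hb h1
  comp_mem_right {n m l} a b hb := by
    have h1 : ∀ a ∈ ⨆ k, (S k).mor m l, T.comp a b ∈ ⨆ k, (S k).mor n l := by
      intro a ha
      refine Submodule.iSup_induction _ (motive := fun a => T.comp a b ∈ ⨆ k, (S k).mor n l) ha
        (fun k x hx => Submodule.mem_iSup_of_mem k ((S k).comp_mem_right b hx)) (by simp) ?_
      intro x y hx hy
      rw [map_add]
      exact add_mem hx hy
    exact map_mem_closure (f := fun a => T.comp a b) (continuous_comp_right b) hb h1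

/-- The ideals `S₀ = N`, `Sₖ₊₁ = J ∩ (⊗1)⁻¹(Sₖ)`. -/
def saturationStep (J N : CatIdeal T) : ℕ → CatIdeal T
  | 0 => N
  | k + 1 => J.inter (saturationStep J N k).tensorPreimage

/-- The `J`-saturation of `N`. -/
def saturation (J N : CatIdeal T) : CatIdeal T := closedSum (saturationStep J N)

/-- The reduction ideal `R_J`: the `J`-saturation of the zero ideal. -/
def reduction (J : CatIdeal T) : CatIdeal T := J.saturation (zero T)

theorem reduction_le (J : CatIdeal T) : J.reduction ≤ J := by
  intro n m
  refine Submodule.topologicalClosure_minimal _ (iSup_le fun k => ?_) (J.isClosed_mor n m)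
  cases k with
  | zero => exact bot_le
  | succ k => exact inf_le_left

/-- `N` is invariant if `N ⊗ 1 ⊆ N`. -/
def Invariant (N : CatIdeal T) : Prop := ∀ n m, ∀ a ∈ N.mor n m, T.tensor a ∈ N.mor (n + 1) (m + 1)

end CatIdeal
end RightTensorCStarPrecategory

namespace RightTensorCStarPrecategory
variable {T : RightTensorCStarPrecategory.{u}}

section Quotient
variable (N : CatIdeal T)

/-- The space of morphisms `T(n,m) / N(n,m)`, with the quotient norm. -/
def QuotHom (n m : ℕ) : Type u := T.Hom n m ⧸ N.mor n m

noncomputable instance (n m : ℕ) : NormedAddCommGroup (QuotHom N n m) :=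
  haveI : IsClosed (N.mor n m : Set (T.Hom n m)) := N.isClosed_mor n m
  inferInstanceAs (NormedAddCommGroup (T.Hom n m ⧸ N.mor n m))

noncomputable instance (n m : ℕ) : NormedSpace ℂ (QuotHom N n m) :=
  inferInstanceAs (NormedSpace ℂ (T.Hom n m ⧸ N.mor n m))

instance (n m : ℕ) : CompleteSpace (QuotHom N n m) :=
  inferInstanceAs (CompleteSpace (T.Hom n m ⧸ N.mor n m))

/-- The quotient map `T(n,m) → T(n,m) / N(n,m)`. -/
def projHom {n m : ℕ} : T.Hom n m →ₗ[ℂ] QuotHom N n m := (N.mor n m).mkQ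

theorem projHom_surjective {n m : ℕ} :
    Function.Surjective (projHom N : T.Hom n m → QuotHom N n m) :=
  Submodule.mkQ_surjective _

theorem projHom_eq {n m : ℕ} {a b : T.Hom n m} :
    projHom N a = projHom N b ↔ a - b ∈ N.mor n m := Submodule.Quotient.eq _

theorem norm_projHom_le {n m : ℕ} (a : T.Hom n m) : ‖projHom N a‖ ≤ ‖a‖ :=
  Submodule.Quotient.norm_mk_le _ a

/-- Composition of morphisms modulo `N`. -/
noncomputable def compQ {n m k : ℕ} : QuotHom N m k →ₗ[ℂ] QuotHom N n m →ₗ[ℂ] QuotHom N n k :=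
  (N.mor m k).liftQ
    { toFun := fun a => (N.mor n m).mapQ (N.mor n k) (T.comp a) (fun _ hb => N.comp_mem_left a hb)
      map_add' := fun a b => by
        refine Submodule.linearMap_qext _ (LinearMap.ext fun c => ?_)
        exact congrArg (projHom N)
          (congrArg (fun L : T.Hom n m →ₗ[ℂ] T.Hom n k => L c) (map_add T.comp a b))
      map_smul' := fun r a => by
        refine Submodule.linearMap_qext _ (LinearMap.ext fun c => ?_)
        exact congrArg (projHom N)
          (congrArg (fun L : T.Hom n m →ₗ[ℂ] T.Hom n k => L c) (map_smul T.comp r a)) }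
    (fun a ha => by
      refine Submodule.linearMap_qext _ (LinearMap.ext fun c => ?_)
      exact (Submodule.Quotient.mk_eq_zero _).2 (N.comp_mem_right c ha))

/-- The involution modulo `N`. -/
noncomputable def adjQ {n m : ℕ} : QuotHom N n m →ₗ⋆[ℂ] QuotHom N m n :=
  (N.mor n m).mapQ (N.mor m n) T.adj (fun _ ha => N.adj_mem ha)

theorem norm_adj_comp_self_quotient {n m : ℕ} (a : T.Hom n m) :
    ‖projHom N a‖ ^ 2 ≤ ‖projHom N (T.comp (T.adj a) a)‖ := by
  refine le_of_forall_pos_le_add fun ε hε => ?_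
  obtain ⟨e, he, hes, hlt⟩ := (N.diag n).exists_approx (T.comp (T.adj a) a) hε
  have hes' : T.adj e = e := hes
  have h1 : projHom N a = projHom N (a - T.comp a e) := by
    rw [projHom_eq, sub_sub_cancel]
    exact N.comp_mem_left a he
  set c := T.comp (T.adj a) a with hcdef
  have h2 : T.comp (T.adj (a - T.comp a e)) (a - T.comp a e) = (c - c * e) - e * (c - c * e) := by
    change _ = (c - T.comp c e) - T.comp e (c - T.comp c e)
    simp only [map_sub, T.adj_comp, hes', LinearMap.sub_apply, hcdef, T.comp_assoc]
    abel
  calc ‖projHom N a‖ ^ 2 ≤ ‖a - T.comp a e‖ ^ 2 := by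
        rw [h1]; gcongr; exact norm_projHom_le N _
    _ = ‖(c - c * e) - e * (c - c * e)‖ := by rw [← T.norm_adj_comp_self, h2]
    _ ≤ _ := hlt.le

/-- The quotient right tensor C⋆-precategory `T / N` by an invariant ideal `N`. -/
noncomputable def quotient (hN : N.Invariant) : RightTensorCStarPrecategory.{u} where
  Hom := QuotHom N
  comp := compQ N
  comp_assoc x y z := by
    obtain ⟨a, rfl⟩ := projHom_surjective N x
    obtain ⟨b, rfl⟩ := projHom_surjective N y
    obtain ⟨c, rfl⟩ := projHom_surjective N z
    exact congrArg (projHom N) (T.comp_assoc a b c)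
  norm_comp_le x y := by
    refine norm_le_mul_of_quotient x y _ ?_
    rintro a b rfl rfl
    exact (norm_projHom_le N (T.comp a b)).trans (T.norm_comp_le a b)
  adj := adjQ N
  adj_adj x := by
    obtain ⟨a, rfl⟩ := projHom_surjective N x
    exact congrArg (projHom N) (T.adj_adj a)
  adj_comp x y := by
    obtain ⟨a, rfl⟩ := projHom_surjective N x
    obtain ⟨b, rfl⟩ := projHom_surjective N y
    exact congrArg (projHom N) (T.adj_comp a b)
  norm_adj_comp_self x := by
    obtain ⟨a, rfl⟩ := projHom_surjective N x
    refine le_antisymm ?_ (norm_adj_comp_self_quotient N a)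
    have h1 : ‖adjQ N (projHom N a)‖ ≤ ‖projHom N a‖ := by
      refine le_of_forall_pos_le_add fun ε hε => ?_
      obtain ⟨b, hb, hlt⟩ := Submodule.Quotient.norm_mk_lt (projHom N a) hε
      rw [← hb] at hlt ⊢
      calc ‖projHom N (T.adj b)‖ ≤ ‖T.adj b‖ := norm_projHom_le N _
        _ = ‖b‖ := norm_adj b
        _ ≤ _ := hlt.le
    have h2 : ‖compQ N (adjQ N (projHom N a)) (projHom N a)‖
        ≤ ‖adjQ N (projHom N a)‖ * ‖projHom N a‖ := by
      refine norm_le_mul_of_quotient _ _ _ ?_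
      intro b c hb hc
      rw [← hb, ← hc]
      exact (norm_projHom_le N (T.comp b c)).trans (T.norm_comp_le b c)
    rw [sq]
    exact h2.trans (by gcongr)
  tensor {n m} := (N.mor n m).mapQ (N.mor (n + 1) (m + 1)) T.tensor (hN n m)
  tensor_comp x y := by
    obtain ⟨a, rfl⟩ := projHom_surjective N x
    obtain ⟨b, rfl⟩ := projHom_surjective N y
    exact congrArg (projHom N) (T.tensor_comp a b)
  tensor_adj x := by
    obtain ⟨a, rfl⟩ := projHom_surjective N x
    exact congrArg (projHom N) (T.tensor_adj a)

/-- The quotient homomorphism `T → T / N`. -/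
noncomputable def toQuotient (hN : N.Invariant) {n m : ℕ} : T.Hom n m →ₗ[ℂ] (quotient N hN).Hom n m := projHom N

/-- The ideal `K / N` of `T / N`, where `N ⊆ K`. -/
noncomputable def CatIdeal.quotient (K : CatIdeal T) (N : CatIdeal T) (hN : N.Invariant) (hK : N ≤ K) :
    CatIdeal (quotient N hN) where
  mor n m := (K.mor n m).map (toQuotient N hN)
  isClosed_mor n m := by
    have h : IsClosed ((N.mor n m).mkQ ⁻¹' ((K.mor n m).map (N.mor n m).mkQ : Set _)) := by
      have : (N.mor n m).mkQ ⁻¹' ((K.mor n m).map (N.mor n m).mkQ : Set _) = K.mor n m := by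
        rw [← Submodule.comap_coe, Submodule.comap_map_mkQ, sup_eq_right.2 (hK n m)]
      rw [this]
      exact K.isClosed_mor n m
    exact ((N.mor n m).isOpenQuotientMap_mkQ.isQuotientMap.isClosed_preimage).1 h
  comp_mem_left x y hy := by
    obtain ⟨a, rfl⟩ := projHom_surjective N x
    obtain ⟨b, hb, rfl⟩ := hy
    exact ⟨T.comp a b, K.comp_mem_left a hb, rfl⟩
  comp_mem_right {n m k x} y hx := by
    obtain ⟨b, rfl⟩ := projHom_surjective N y
    obtain ⟨a, ha, rfl⟩ := hx
    exact ⟨T.comp a b, K.comp_mem_right b ha, rfl⟩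
end Quotient

/-- A right tensor representation `{π n m : K(m,n) → B}` of an ideal `K` in `T` in a
C⋆-algebra `B`. -/
structure TensorRep (K : CatIdeal T) (B : Type w) [NonUnitalCStarAlgebra B] where
  π : ∀ n m : ℕ, K.mor m n →ₗ[ℂ] B
  map_adj : ∀ {n m : ℕ} (a : K.mor m n), star (π n m a) = π m n ⟨T.adj a, K.adj_mem a.2⟩
  map_comp : ∀ {n m l : ℕ} (a : K.mor m n) (b : K.mor l m),
    π n m a * π m l b = π n l ⟨T.comp a.1 b.1, K.comp_mem_left a.1 b.2⟩
  map_tensor : ∀ {n m l k : ℕ} (a : K.mor m n) (b : K.mor l (m + k)),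
    π n m a * π (m + k) l b = π (n + k) l ⟨T.comp (tensorIter k a.1) b, K.comp_mem_left (tensorIter k a.1) b.2⟩

namespace TensorRep
variable {K : CatIdeal T} {B : Type w} [NonUnitalCStarAlgebra B]

/-- `π` is coisometric on the ideal `J ⊆ J(K)`: `π n m a = π (n+1) (m+1) (a ⊗ 1)` for `a ∈ J`. -/
def CoisometricOn (ρ : TensorRep K B) (J : CatIdeal T) : Prop :=
  ∀ (n m : ℕ) (a : T.Hom m n) (_ : a ∈ J.mor m n) (ha : a ∈ K.mor m n)
    (ha' : T.tensor a ∈ K.mor (m + 1) (n + 1)), ρ.π n m ⟨a, ha⟩ = ρ.π (n + 1) (m + 1) ⟨T.tensor a, ha'⟩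

theorem norm_le (ρ : TensorRep K B) {n m : ℕ} (a : K.mor m n) : ‖ρ.π n m a‖ ≤ ‖a‖ := by
  let S : NonUnitalStarSubalgebra ℂ (T.Hom m m) :=
    { carrier := K.mor m m
      add_mem' := fun ha hb => add_mem ha hb
      zero_mem' := zero_mem _
      mul_mem' := fun {b} _ _ hc => K.comp_mem_left b hc
      smul_mem' := fun r _ ha => Submodule.smul_mem _ r ha
      star_mem' := fun ha => K.adj_mem ha }
  let _ : NonUnitalCStarAlgebra S :=
    NonUnitalStarSubalgebra.nonUnitalCStarAlgebra S (h_closed := K.isClosed_mor m m)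
  let φ : S →⋆ₙₐ[ℂ] B :=
    { toFun := fun b => ρ.π m m ⟨b.1, b.2⟩
      map_smul' := fun r b => (ρ.π m m).map_smul r ⟨b.1, b.2⟩
      map_zero' := (ρ.π m m).map_zero
      map_add' := fun b c => (ρ.π m m).map_add ⟨b.1, b.2⟩ ⟨c.1, c.2⟩
      map_mul' := fun b c => (ρ.map_comp ⟨b.1, b.2⟩ ⟨c.1, c.2⟩).symm
      map_star' := fun b => (ρ.map_adj ⟨b.1, b.2⟩).symm }
  have h := NonUnitalStarAlgHom.norm_apply_le φ ⟨T.comp (T.adj a.1) a.1, K.comp_mem_left (T.adj a.1) a.2⟩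
  have h1 : φ ⟨T.comp (T.adj a.1) a.1, K.comp_mem_left (T.adj a.1) a.2⟩ = star (ρ.π n m a) * ρ.π n m a := by
    rw [ρ.map_adj, ρ.map_comp]
    rfl
  have h2 : ‖(⟨T.comp (T.adj a.1) a.1, K.comp_mem_left (T.adj a.1) a.2⟩ : S)‖ = ‖a‖ ^ 2 :=
    T.norm_adj_comp_self a.1
  rw [h1, h2, CStarRing.norm_star_mul_self, ← sq] at h
  exact le_of_sq_le_sq h (norm_nonneg _)
end TensorRep

/-- A right tensor representation of `K` coisometric on `J`, in some C⋆-algebra. -/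
structure RepIndex (K J : CatIdeal T) where
  B : Type u
  [instB : NonUnitalCStarAlgebra B]
  rep : TensorRep K B
  coisometric : rep.CoisometricOn J

attribute [instance] RepIndex.instB

/-- The value at `a ∈ K(m,n)` of the representation with index `i`. -/
def RepIndex.value {K J : CatIdeal T} (i : RepIndex K J) (g : Σ p : ℕ × ℕ, K.mor p.2 p.1) : i.B :=
  i.rep.π g.1.1 g.1.2 g.2

theorem RepIndex.value_bounded (K J : CatIdeal T) (g : Σ p : ℕ × ℕ, K.mor p.2 p.1) :
    ∃ C : ℝ, ∀ i : RepIndex K J, ‖i.value g‖ ≤ C :=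
  ⟨‖g.2‖, fun i => i.rep.norm_le g.2⟩

/-- The C⋆-algebra `O_T(K,J)`: the universal C⋆-algebra for right tensor representations of `K`
coisometric on `J`. -/
def OAlg (K J : CatIdeal T) : Type (u + 1) :=
  univAlg (fun i : RepIndex K J => i.value) (RepIndex.value_bounded K J)

noncomputable instance (K J : CatIdeal T) : NonUnitalCStarAlgebra (OAlg K J) :=
  univAlg.instCStar _ _

/-- The universal representation `i_{(n,m)} : K(m,n) → O_T(K,J)`. -/
def univRep (K J : CatIdeal T) : TensorRep K (OAlg K J) where
  π n m :=
    { toFun := fun a => ⟨univGen _ (RepIndex.value_bounded K J) ⟨(n, m), a⟩, univGen_mem _ _ _⟩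
      map_add' := fun a b => Subtype.ext (Subtype.ext (funext fun i => (i.rep.π n m).map_add a b))
      map_smul' := fun r a => Subtype.ext (Subtype.ext (funext fun i => (i.rep.π n m).map_smul r a)) }
  map_adj a := Subtype.ext (Subtype.ext (funext fun i => i.rep.map_adj a))
  map_comp a b := Subtype.ext (Subtype.ext (funext fun i => i.rep.map_comp a b))
  map_tensor a b := Subtype.ext (Subtype.ext (funext fun i => i.rep.map_tensor a b))

theorem univRep_coisometric (K J : CatIdeal T) : (univRep K J).CoisometricOn J :=
  fun n m a h1 h2 h3 =>
    Subtype.ext (Subtype.ext (funext fun i => i.coisometric n m a h1 h2 h3))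

/-- The universal property of `O_T(K,J)`. -/
theorem existsUnique_integrate (K J : CatIdeal T) {B : Type u} [NonUnitalCStarAlgebra B]
    (ρ : TensorRep K B) (hρ : ρ.CoisometricOn J) :
    ∃! Ψ : OAlg K J →⋆ₙₐ[ℂ] B, ∀ n m (a : K.mor m n), Ψ ((univRep K J).π n m a) = ρ.π n m a := by
  refine ⟨univEval (fun i : RepIndex K J => i.value) (RepIndex.value_bounded K J) ⟨B, ρ, hρ⟩,
    fun n m a => rfl, fun Ψ hΨ => ?_⟩
  refine univAlg_hom_ext _ _ ?_
  rintro ⟨⟨n, m⟩, a⟩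
  exact hΨ n m a

end RightTensorCStarPrecategory

/-! ### Hilbert modules and C⋆-correspondences -/

/-- A right Hilbert module over the C⋆-algebra `A`, with inner product linear in the second
variable; `rsmul x a` is `x · a`. (Mathlib's `CStarModule` is about left modules.) -/
structure HilbertModule (A : Type u) [NonUnitalCStarAlgebra A] where
  carrier : Type v
  [instNormed : NormedAddCommGroup carrier]
  [instSpace : NormedSpace ℂ carrier]
  [instComplete : CompleteSpace carrier]
  rsmul : carrier →ₗ[ℂ] A →ₗ[ℂ] carrier
  rsmul_mul : ∀ x a b, rsmul (rsmul x a) b = rsmul x (a * b)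
  inner : carrier → carrier → A
  inner_add : ∀ x y z, inner x (y + z) = inner x y + inner x z
  inner_smul : ∀ (r : ℂ) x y, inner x (r • y) = r • inner x y
  inner_rsmul : ∀ x y a, inner x (rsmul y a) = inner x y * a
  star_inner : ∀ x y, star (inner x y) = inner y x
  inner_self_pos : ∀ x, ∃ b, inner x x = star b * b
  norm_sq : ∀ x, ‖x‖ ^ 2 = ‖inner x x‖

attribute [instance] HilbertModule.instNormed HilbertModule.instSpace HilbertModule.instComplete

/-- A C⋆-correspondence over `A`: a right Hilbert `A`-module with a left action
`a · x = φ a x` of `A` by adjointable operators, the adjoint of `φ a` being `φ (star a)`. -/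
structure CStarCorrespondence (A : Type u) [NonUnitalCStarAlgebra A] extends
    HilbertModule.{u, v} A where
  φ : A →ₙₐ[ℂ] (carrier →L[ℂ] carrier)
  inner_φ : ∀ a x y, inner (φ a x) y = inner x (φ (star a) y)

namespace HilbertModule
variable {A : Type u} [NonUnitalCStarAlgebra A] (X : HilbertModule.{u, v} A)

theorem norm_inner_le (x y : X.carrier) : ‖X.inner x y‖ ≤ ‖x‖ * ‖y‖ := by
  let _ : PartialOrder Aᵐᵒᵖ := CStarAlgebra.spectralOrder _
  have : StarOrderedRing Aᵐᵒᵖ := CStarAlgebra.spectralOrderedRing _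
  let _ : SMul Aᵐᵒᵖ X.carrier := ⟨fun a x => X.rsmul x a.unop⟩
  let inst : CStarModule Aᵐᵒᵖ X.carrier :=
    { inner := fun x y => MulOpposite.op (X.inner x y)
      inner_add_right := fun {x y z} => congrArg MulOpposite.op (X.inner_add x y z)
      inner_self_nonneg := fun {x} => by
        obtain ⟨b, hb⟩ := X.inner_self_pos x
        change 0 ≤ MulOpposite.op (X.inner x x)
        rw [hb, MulOpposite.op_mul, MulOpposite.op_star]
        exact mul_star_self_nonneg _
      inner_self := fun {x} => by
        change MulOpposite.op (X.inner x x) = 0 ↔ x = 0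
        rw [MulOpposite.op_eq_zero_iff, ← norm_eq_zero, ← X.norm_sq, pow_eq_zero_iff two_ne_zero,
          norm_eq_zero]
      inner_op_smul_right := fun {a x y} => by
        change MulOpposite.op (X.inner x (X.rsmul y a.unop)) = a * MulOpposite.op (X.inner x y)
        rw [X.inner_rsmul, MulOpposite.op_mul, MulOpposite.op_unop]
      inner_smul_right_complex := fun {r x y} => congrArg MulOpposite.op (X.inner_smul r x y)
      star_inner := fun x y => congrArg MulOpposite.op (X.star_inner x y)
      norm_eq_sqrt_norm_inner_self := fun x => by
        change ‖x‖ = √‖X.inner x x‖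
        rw [← X.norm_sq, Real.sqrt_sq (norm_nonneg x)] }
  exact CStarModule.norm_inner_le (A := Aᵐᵒᵖ) X.carrier (x := x) (y := y)

theorem inner_add_left (x y z : X.carrier) : X.inner (x + y) z = X.inner x z + X.inner y z := by
  rw [← X.star_inner, X.inner_add, star_add, X.star_inner, X.star_inner]

theorem inner_smul_left (r : ℂ) (x y : X.carrier) : X.inner (r • x) y = star r • X.inner x y := by
  rw [← X.star_inner, X.inner_smul, star_smul, X.star_inner]

theorem inner_rsmul_left (x y : X.carrier) (a : A) :
    X.inner (X.rsmul x a) y = star a * X.inner x y := by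
  rw [← X.star_inner, X.inner_rsmul, star_mul, X.star_inner]

/-- The inner product with a fixed first variable, as a continuous linear map. -/
noncomputable def innerCLM (x : X.carrier) : X.carrier →L[ℂ] A :=
  LinearMap.mkContinuous
    { toFun := fun y => X.inner x y
      map_add' := X.inner_add x
      map_smul' := fun r y => X.inner_smul r x y } ‖x‖ (fun y => X.norm_inner_le x y)

theorem norm_rsmul_le (x : X.carrier) (a : A) : ‖X.rsmul x a‖ ≤ ‖x‖ * ‖a‖ := by
  refine le_of_sq_le_sq ?_ (by positivity)
  rw [X.norm_sq, X.inner_rsmul, X.inner_rsmul_left]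
  calc ‖star a * X.inner x x * a‖ ≤ ‖star a‖ * ‖X.inner x x‖ * ‖a‖ :=
        (norm_mul_le _ _).trans (by gcongr; exact norm_mul_le _ _)
    _ = _ := by rw [norm_star, ← X.norm_sq]; ring

/-- The operator `Θ_{x,y} : z ↦ x · ⟨y, z⟩`. -/
noncomputable def rankOne (x y : X.carrier) : X.carrier →L[ℂ] X.carrier :=
  LinearMap.mkContinuous ((X.rsmul x).comp (X.innerCLM y).toLinearMap) (‖x‖ * ‖y‖) (fun z => by
    rw [mul_assoc]
    exact (X.norm_rsmul_le x _).trans (by gcongr; exact X.norm_inner_le y z))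

/-- The space `K(X)` of compact operators, the closed linear span of the `Θ_{x,y}`. -/
noncomputable def compacts : Submodule ℂ (X.carrier →L[ℂ] X.carrier) :=
  (Submodule.span ℂ {k | ∃ x y, k = X.rankOne x y}).topologicalClosure

theorem rankOne_mem (x y : X.carrier) : X.rankOne x y ∈ X.compacts :=
  Submodule.le_topologicalClosure _ (Submodule.subset_span ⟨x, y, rfl⟩)

/-- The submodule `XI = {x i | x ∈ X, i ∈ I} = {x | ⟨x, y⟩ ∈ I for all y ∈ X}`, in its second
description. -/
def sub (I : ClosedIdeal A) : Submodule ℂ X.carrier where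
  carrier := {x | ∀ y, X.inner x y ∈ I.toSubmodule}
  add_mem' hx hy z := by rw [X.inner_add_left]; exact add_mem (hx z) (hy z)
  zero_mem' z := by
    have : X.inner (0 : X.carrier) z = 0 := by
      rw [← X.star_inner]
      exact (congrArg star (map_zero (X.innerCLM z))).trans (star_zero A)
    rw [this]
    exact zero_mem _
  smul_mem' r x hx z := by rw [X.inner_smul_left]; exact Submodule.smul_mem _ _ (hx z)

theorem inner_mem_of_right {I : ClosedIdeal A} {x y : X.carrier} (hy : y ∈ X.sub I) :
    X.inner x y ∈ I.toSubmodule := by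
  rw [← X.star_inner]
  exact I.star_mem (hy x)

theorem isClosed_sub (I : ClosedIdeal A) : IsClosed (X.sub I : Set X.carrier) := by
  have : (X.sub I : Set X.carrier) = ⋂ y, X.innerCLM y ⁻¹' (I.toSubmodule : Set A) := by
    ext x
    simp only [Set.mem_iInter, Set.mem_preimage]
    refine ⟨fun h y => X.inner_mem_of_right h, fun h y => ?_⟩
    rw [← X.star_inner]
    exact I.star_mem (h y)
  rw [this]
  exact isClosed_iInter fun y =>
    IsClosed.preimage (X.innerCLM y).continuous I.isClosed'

theorem rsmul_mem_sub {I : ClosedIdeal A} (x : X.carrier) {a : A} (ha : a ∈ I.toSubmodule) :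
    X.rsmul x a ∈ X.sub I := fun y => by
  rw [X.inner_rsmul_left]
  exact I.mul_mem_right' _ (I.star_mem ha)

/-- `XI` is the closed linear span of the products `x · a` with `x ∈ X` and `a ∈ I`. -/
theorem sub_eq_closedSpan (I : ClosedIdeal A) :
    X.sub I = (Submodule.span ℂ
      {z | ∃ x : X.carrier, ∃ a ∈ I.toSubmodule, z = X.rsmul x a}).topologicalClosure := by
  refine le_antisymm (fun x hx => ?_) (Submodule.topologicalClosure_minimal _
    (Submodule.span_le.2 ?_) (X.isClosed_sub I))
  · change x ∈ closure _
    rw [Metric.mem_closure_iff]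
    intro ε hε
    obtain ⟨e, he, hes, hen, -, hce⟩ := I.exists_local_unit (hx x) (X.star_inner x x)
      (ε := ε ^ 2 / 2) (by positivity)
    refine ⟨X.rsmul x e, Submodule.subset_span ⟨x, e, he, rfl⟩, ?_⟩
    rw [dist_eq_norm]
    set c := X.inner x x with hc
    have h0 : ∀ y z w : X.carrier, X.inner y (z - w) = X.inner y z - X.inner y w :=
      fun y z w => map_sub (X.innerCLM y) z w
    have h1 : X.inner (x - X.rsmul x e) (x - X.rsmul x e) = (c - c * e) - e * (c - c * e) := by
      have h2 : ∀ y z w : X.carrier, X.inner (z - w) y = X.inner z y - X.inner w y := fun y z w => by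
        rw [← X.star_inner, h0, star_sub, X.star_inner, X.star_inner]
      rw [h0, h2, h2, X.inner_rsmul, X.inner_rsmul, X.inner_rsmul_left, hes, ← hc]
      noncomm_ring
    refine lt_of_pow_lt_pow_left₀ 2 hε.le ?_
    rw [X.norm_sq, h1]
    calc _ ≤ ‖c - c * e‖ + ‖e‖ * ‖c - c * e‖ :=
          (norm_sub_le _ _).trans (by gcongr; exact norm_mul_le _ _)
      _ ≤ ‖c - c * e‖ + 1 * ‖c - c * e‖ := by gcongr
      _ < ε ^ 2 := by linarith
  · rintro _ ⟨x, a, ha, rfl⟩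
    exact X.rsmul_mem_sub x ha

section Quotient
variable (I : ClosedIdeal A)

/-- The quotient space `X / XI`. -/
def QuotCarrier : Type v := X.carrier ⧸ X.sub I

noncomputable instance : NormedAddCommGroup (X.QuotCarrier I) :=
  haveI : IsClosed (X.sub I : Set X.carrier) := X.isClosed_sub I
  inferInstanceAs (NormedAddCommGroup (X.carrier ⧸ X.sub I))

noncomputable instance : NormedSpace ℂ (X.QuotCarrier I) :=
  inferInstanceAs (NormedSpace ℂ (X.carrier ⧸ X.sub I))

instance : CompleteSpace (X.QuotCarrier I) :=
  inferInstanceAs (CompleteSpace (X.carrier ⧸ X.sub I))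

/-- The quotient map `X → X / XI`. -/
def proj : X.carrier →ₗ[ℂ] X.QuotCarrier I := (X.sub I).mkQ

theorem proj_surjective : Function.Surjective (X.proj I) := Submodule.mkQ_surjective _

theorem proj_eq_zero {x : X.carrier} (hx : x ∈ X.sub I) : X.proj I x = 0 :=
  (Submodule.Quotient.mk_eq_zero _).2 hx

/-- The quotient map `A → A / I`, as a linear map. -/
def _root_.ClosedIdeal.projₗ : A →ₗ[ℂ] I.Quotient := I.toSubmodule.mkQ

/-- The action `q(x) · q(a) = q(x · a)`. -/
noncomputable def rsmulQ : X.QuotCarrier I →ₗ[ℂ] I.Quotient →ₗ[ℂ] X.QuotCarrier I :=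
  (X.sub I).liftQ
    { toFun := fun x => I.toSubmodule.mapQ (X.sub I) (X.rsmul x)
        (fun _ ha => X.rsmul_mem_sub x ha)
      map_add' := fun x y => by
        refine Submodule.linearMap_qext _ (LinearMap.ext fun a => ?_)
        exact congrArg (X.proj I)
          (congrArg (fun L : A →ₗ[ℂ] X.carrier => L a) (map_add X.rsmul x y))
      map_smul' := fun r x => by
        refine Submodule.linearMap_qext _ (LinearMap.ext fun a => ?_)
        exact congrArg (X.proj I)
          (congrArg (fun L : A →ₗ[ℂ] X.carrier => L a) (map_smul X.rsmul r x)) }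
    (fun x hx => by
      refine Submodule.linearMap_qext _ (LinearMap.ext fun a => ?_)
      refine (Submodule.Quotient.mk_eq_zero _).2 (fun y => ?_)
      rw [X.inner_rsmul_left]
      exact I.mul_mem_left' _ (hx y))

/-- The inner product `⟨q(x), q(y)⟩ = q(⟨x, y⟩)`. -/
noncomputable def innerQ : X.QuotCarrier I → X.QuotCarrier I → I.Quotient :=
  Quotient.map₂ X.inner (by
    intro x x' hx y y' hy
    have hx' : x - x' ∈ X.sub I := (Submodule.quotientRel_def _).1 hx
    have hy' : y - y' ∈ X.sub I := (Submodule.quotientRel_def _).1 hy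
    refine (Submodule.quotientRel_def _).2 ?_
    have h : X.inner x y - X.inner x' y' = X.inner (x - x') y + X.inner x' (y - y') := by
      have h1 : X.inner x y = X.inner (x - x') y + X.inner x' y := by
        rw [← X.inner_add_left, sub_add_cancel]
      have h2 : X.inner x' y = X.inner x' (y - y') + X.inner x' y' := by
        rw [← X.inner_add, sub_add_cancel]
      rw [h1, h2]
      abel
    rw [h]
    exact add_mem (hx' y) (X.inner_mem_of_right hy'))

theorem norm_sq_quotient (x : X.carrier) :
    ‖X.proj I x‖ ^ 2 = ‖I.proj (X.inner x x)‖ := by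
  refine le_antisymm ?_ ?_
  · refine le_of_forall_pos_le_add fun ε hε => ?_
    obtain ⟨e, he, hes, hlt⟩ := I.exists_approx (X.inner x x) hε
    have h1 : X.proj I x = X.proj I (x - X.rsmul x e) := by
      rw [map_sub, X.proj_eq_zero I (X.rsmul_mem_sub x he), sub_zero]
    have h2 : ‖x - X.rsmul x e‖ ^ 2 ≤ ‖I.proj (X.inner x x)‖ + ε := by
      rw [X.norm_sq]
      have : X.inner (x - X.rsmul x e) (x - X.rsmul x e) = (X.inner x x - X.inner x x * e)
          - e * (X.inner x x - X.inner x x * e) := by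
        have hr : ∀ z, X.inner z (x - X.rsmul x e) = X.inner z x - X.inner z x * e := fun z => by
          have := map_sub (X.innerCLM z) x (X.rsmul x e)
          exact this.trans (congrArg _ (X.inner_rsmul z x e))
        have hl : ∀ z, X.inner (x - X.rsmul x e) z = X.inner x z - e * X.inner x z := fun z => by
          rw [← X.star_inner]
          have := map_sub (X.innerCLM z) x (X.rsmul x e)
          refine (congrArg star this).trans ?_
          rw [star_sub]
          change star (X.inner z x) - star (X.inner z (X.rsmul x e)) = _
          rw [X.star_inner, X.star_inner, X.inner_rsmul_left, hes]
        rw [hr, hl]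
        noncomm_ring
      rw [this]
      exact hlt.le
    rw [h1]
    refine le_trans ?_ h2
    gcongr
    exact Submodule.Quotient.norm_mk_le _ _
  · rw [sq]
    refine norm_le_mul_of_quotient (S := X.sub I) (S' := X.sub I) _ _ _ ?_
    intro y z hy hz
    have : I.proj (X.inner x x) = I.proj (X.inner y z) := by
      change X.innerQ I (X.proj I x) (X.proj I x) = X.innerQ I (X.proj I y) (X.proj I z)
      exact congrArg₂ (X.innerQ I) hy.symm hz.symm
    rw [this]
    exact (I.norm_proj_le _).trans (X.norm_inner_le y z)

/-- The Hilbert `A / I`-module `X / XI`. -/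
noncomputable def quotient : HilbertModule.{u, v} I.Quotient where
  carrier := X.QuotCarrier I
  rsmul := X.rsmulQ I
  rsmul_mul x a b := by
    obtain ⟨x, rfl⟩ := X.proj_surjective I x
    obtain ⟨a, rfl⟩ := I.proj_surjective a
    obtain ⟨b, rfl⟩ := I.proj_surjective b
    exact congrArg (X.proj I) (X.rsmul_mul x a b)
  inner := X.innerQ I
  inner_add x y z := by
    obtain ⟨x, rfl⟩ := X.proj_surjective I x
    obtain ⟨y, rfl⟩ := X.proj_surjective I y
    obtain ⟨z, rfl⟩ := X.proj_surjective I z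
    exact congrArg I.proj (X.inner_add x y z)
  inner_smul r x y := by
    obtain ⟨x, rfl⟩ := X.proj_surjective I x
    obtain ⟨y, rfl⟩ := X.proj_surjective I y
    exact congrArg I.proj (X.inner_smul r x y)
  inner_rsmul x y a := by
    obtain ⟨x, rfl⟩ := X.proj_surjective I x
    obtain ⟨y, rfl⟩ := X.proj_surjective I y
    obtain ⟨a, rfl⟩ := I.proj_surjective a
    exact congrArg I.proj (X.inner_rsmul x y a)
  star_inner x y := by
    obtain ⟨x, rfl⟩ := X.proj_surjective I x
    obtain ⟨y, rfl⟩ := X.proj_surjective I y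
    exact congrArg I.proj (X.star_inner x y)
  inner_self_pos x := by
    obtain ⟨x, rfl⟩ := X.proj_surjective I x
    obtain ⟨b, hb⟩ := X.inner_self_pos x
    exact ⟨I.proj b, congrArg I.proj hb⟩
  norm_sq x := by
    obtain ⟨x, rfl⟩ := X.proj_surjective I x
    exact X.norm_sq_quotient I x
end Quotient
end HilbertModule

namespace CStarCorrespondence
variable {A : Type u} [NonUnitalCStarAlgebra A] (X : CStarCorrespondence.{u, v} A)

theorem norm_φ_le (a : A) (x : X.carrier) : ‖X.φ a x‖ ≤ ‖a‖ * ‖x‖ := by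
  let _ : PartialOrder A := CStarAlgebra.spectralOrder A
  have : StarOrderedRing A := CStarAlgebra.spectralOrderedRing A
  set b := star a * a with hb
  have hbs : IsSelfAdjoint b := IsSelfAdjoint.star_mul_self a
  have hbn : ‖b‖ = ‖a‖ * ‖a‖ := CStarRing.norm_star_mul_self
  let g : ℝ → ℝ := fun t => √(‖b‖ - t) - ‖a‖
  have hsq : √‖b‖ = ‖a‖ := by rw [hbn, Real.sqrt_mul_self (norm_nonneg a)]
  have hg : Continuous g := by fun_prop
  have hg0 : g 0 = 0 := by simp [g, hsq]
  set d := cfcₙ g b with hd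
  have hds : star d = d := cfcₙ_predicate g b
  have hdd : d * d + (2 * ‖a‖) • d = -b := by
    rw [hd, ← cfcₙ_mul g g b hg.continuousOn hg0 hg.continuousOn hg0,
      ← cfcₙ_smul (2 * ‖a‖) g b hg.continuousOn hg0,
      ← cfcₙ_add (fun t => g t * g t) (fun t => (2 * ‖a‖) • g t) b
        (by fun_prop) (by simp [hg0]) (by fun_prop) (by simp [hg0])]
    conv_rhs => rw [← cfcₙ_id' ℝ b, ← cfcₙ_neg (fun t : ℝ => t) b]
    refine cfcₙ_congr fun t ht => ?_
    have ht' : t ≤ ‖b‖ := by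
      have := norm_apply_le_norm_cfcₙ (fun t : ℝ => t) b ht (by fun_prop) rfl hbs
      rw [cfcₙ_id' ℝ b] at this
      exact (le_abs_self t).trans this
    have h := Real.mul_self_sqrt (sub_nonneg.2 ht')
    simp only [g, smul_eq_mul]
    nlinarith
  let y : X.carrier := (‖a‖ : ℂ) • x + X.φ d x
  have hy : X.inner y y + X.inner (X.φ a x) (X.φ a x) = ((‖a‖ * ‖a‖ : ℝ) : ℂ) • X.inner x x := by
    have h1 : X.inner (X.φ a x) (X.φ a x) = X.inner x (X.φ b x) := by
      rw [X.inner_φ, hb, map_mul]; rfl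
    have h2 : X.inner y y = ((‖a‖ * ‖a‖ : ℝ) : ℂ) • X.inner x x
        + X.inner x (X.φ (d * d + (2 * ‖a‖) • d) x) := by
      have e1 : X.φ (d * d + (2 * ‖a‖) • d) x
          = X.φ d (X.φ d x) + ((2 * ‖a‖ : ℝ) : ℂ) • X.φ d x := by
        rw [map_add, map_mul, ← Complex.coe_smul, map_smul]
        rfl
      rw [e1, X.inner_add, X.inner_smul]
      simp only [y, X.inner_add, X.inner_add_left, X.inner_smul, X.inner_smul_left, X.inner_φ d, hds]
      simp only [RCLike.star_def, Complex.conj_ofReal, Complex.ofReal_mul, Complex.ofReal_ofNat]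
      module
    have h3 : X.inner x (X.φ (-b) x) = - X.inner x (X.φ b x) := by
      rw [map_neg]
      exact map_neg (X.innerCLM x) (X.φ b x)
    rw [h1, h2, hdd, h3]
    abel
  obtain ⟨p, hp⟩ := X.inner_self_pos y
  obtain ⟨q, hq⟩ := X.inner_self_pos (X.φ a x)
  have hle : X.inner (X.φ a x) (X.φ a x) ≤ ((‖a‖ * ‖a‖ : ℝ) : ℂ) • X.inner x x := by
    rw [← hy, hp]
    exact le_add_of_nonneg_left (star_mul_self_nonneg p)
  have h0 : 0 ≤ X.inner (X.φ a x) (X.φ a x) := by rw [hq]; exact star_mul_self_nonneg q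
  have hn := CStarAlgebra.norm_le_norm_of_nonneg_of_le h0 hle
  rw [← X.norm_sq, norm_smul, ← X.norm_sq, Complex.norm_real, Real.norm_eq_abs,
    abs_of_nonneg (by positivity)] at hn
  refine le_of_sq_le_sq ?_ (by positivity)
  calc _ ≤ _ := hn
    _ = _ := by ring

/-- The ideal `J(X) = φ⁻¹(K(X))`, as a subspace of `A`. -/
noncomputable def idealJ : Submodule ℂ A := X.compacts.comap (X.φ : A →ₗ[ℂ] _)

/-- The kernel of `φ`, as a subspace of `A`. -/
def kerφ : Submodule ℂ A where
  carrier := {a | X.φ a = 0}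
  add_mem' ha hb := (map_add X.φ _ _).trans (by rw [ha, hb, add_zero])
  zero_mem' := map_zero X.φ
  smul_mem' r a ha := (map_smul X.φ r a).trans (by rw [ha, smul_zero])

/-- `I` is `X`-invariant if `φ(I) X ⊆ XI`. -/
def Invariant (I : ClosedIdeal A) : Prop :=
  ∀ a ∈ I.toSubmodule, ∀ x, X.φ a x ∈ X.sub I

/-- The ideal `{a | φ(a) X ⊆ XI}`. -/
def preimage (I : ClosedIdeal A) : ClosedIdeal A where
  carrier := {a | ∀ x, X.φ a x ∈ X.sub I}
  add_mem' ha hb x := by rw [map_add]; exact add_mem (ha x) (hb x)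
  zero_mem' x := by rw [map_zero]; exact zero_mem _
  smul_mem' r a ha x := by rw [map_smul]; exact Submodule.smul_mem _ r (ha x)
  mul_mem_left' a b hb x := fun y => by
    rw [map_mul]
    change X.inner (X.φ a (X.φ b x)) y ∈ _
    rw [X.inner_φ]
    exact hb x _
  mul_mem_right' a b hb x := by rw [map_mul]; exact hb _
  isClosed' := by
    have : {a : A | ∀ x, X.φ a x ∈ X.sub I}
        = ⋂ x, (fun a => X.φ a x) ⁻¹' (X.sub I : Set X.carrier) := by
      ext a; simp
    rw [this]
    refine isClosed_iInter fun x => (X.isClosed_sub I).preimage ?_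
    let L : A →ₗ[ℂ] X.carrier :=
      { toFun := fun a => X.φ a x
        map_add' := fun a b => by rw [map_add]; rfl
        map_smul' := fun r a => by rw [map_smul]; rfl }
    exact AddMonoidHomClass.continuous_of_bound L ‖x‖
      (fun a => by rw [mul_comm]; exact X.norm_φ_le a x)

/-- The ideals `S₀ = I`, `Sₖ₊₁ = {a ∈ J | φ(a) X ⊆ X Sₖ}`. -/
def saturationStep (J I : ClosedIdeal A) : ℕ → ClosedIdeal A
  | 0 => I
  | k + 1 => J.inter (X.preimage (saturationStep J I k))

/-- The `J`-saturation of `I`. -/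
def saturation (J I : ClosedIdeal A) : ClosedIdeal A :=
  ClosedIdeal.closedSum (X.saturationStep J I)

/-- The reduction ideal `R_J`: the `J`-saturation of the zero ideal. -/
def reduction (J : ClosedIdeal A) : ClosedIdeal A := X.saturation J (ClosedIdeal.zero A)

theorem reduction_le (J : ClosedIdeal A) : (X.reduction J).toSubmodule ≤ J.toSubmodule := by
  refine Submodule.topologicalClosure_minimal _ (iSup_le fun k => ?_) J.isClosed'
  cases k with
  | zero => exact bot_le
  | succ k => exact inf_le_left

end CStarCorrespondence

namespace ClosedIdeal
variable {A : Type u} [NonUnitalCStarAlgebra A]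

/-- The ideal `J / I` of `A / I`, where `I ⊆ J`. -/
noncomputable def quotient (J I : ClosedIdeal A) (h : I.toSubmodule ≤ J.toSubmodule) :
    ClosedIdeal I.Quotient where
  toSubmodule := J.toSubmodule.map I.projₗ
  mul_mem_left' x y hy := by
    obtain ⟨a, rfl⟩ := I.proj_surjective x
    obtain ⟨b, hb, rfl⟩ := hy
    exact ⟨a * b, J.mul_mem_left' a hb, rfl⟩
  mul_mem_right' x y hy := by
    obtain ⟨a, rfl⟩ := I.proj_surjective x
    obtain ⟨b, hb, rfl⟩ := hy
    exact ⟨b * a, J.mul_mem_right' a hb, rfl⟩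
  isClosed' := by
    have hc : IsClosed (I.toSubmodule.mkQ ⁻¹' (J.toSubmodule.map I.toSubmodule.mkQ : Set _)) := by
      have : I.toSubmodule.mkQ ⁻¹' (J.toSubmodule.map I.toSubmodule.mkQ : Set _)
          = J.toSubmodule := by
        rw [← Submodule.comap_coe, Submodule.comap_map_mkQ, sup_eq_right.2 h]
      rw [this]
      exact J.isClosed'
    exact (I.toSubmodule.isOpenQuotientMap_mkQ.isQuotientMap.isClosed_preimage).1 hc

end ClosedIdeal

namespace CStarCorrespondence
variable {A : Type u} [NonUnitalCStarAlgebra A] (X : CStarCorrespondence.{u, v} A)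

section Quotient
variable (I : ClosedIdeal A) (hI : X.Invariant I)

theorem φ_mem_sub (a : A) {x : X.carrier} (hx : x ∈ X.sub I) : X.φ a x ∈ X.sub I := fun y => by
  rw [X.inner_φ]
  exact hx _

/-- The operator on `X / XI` induced by `φ a`. -/
noncomputable def φOp (a : A) : X.QuotCarrier I →L[ℂ] X.QuotCarrier I :=
  LinearMap.mkContinuous
    ((X.sub I).mapQ (X.sub I) (X.φ a : X.carrier →ₗ[ℂ] X.carrier) (fun _ hx => X.φ_mem_sub I a hx))
    ‖a‖ (fun x => by
      refine le_of_forall_pos_le_add fun ε hε => ?_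
      obtain ⟨y, rfl, hlt⟩ := Submodule.Quotient.norm_mk_lt x (ε := ε / (‖a‖ + 1)) (by positivity)
      calc ‖X.proj I (X.φ a y)‖ ≤ ‖X.φ a y‖ := Submodule.Quotient.norm_mk_le _ _
        _ ≤ ‖a‖ * ‖y‖ := X.norm_φ_le a y
        _ ≤ ‖a‖ * (‖X.proj I y‖ + ε / (‖a‖ + 1)) := by gcongr; exact hlt.le
        _ = ‖a‖ * ‖X.proj I y‖ + ‖a‖ / (‖a‖ + 1) * ε := by ring
        _ ≤ ‖a‖ * ‖X.proj I y‖ + 1 * ε := by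
            gcongr
            rw [div_le_one (by positivity)]
            linarith
        _ = ‖a‖ * ‖X.proj I y‖ + ε := by rw [one_mul])

theorem φOp_proj (a : A) (x : X.carrier) : X.φOp I a (X.proj I x) = X.proj I (X.φ a x) := rfl

theorem clm_ext_proj {S S' : X.QuotCarrier I →L[ℂ] X.QuotCarrier I}
    (h : ∀ x, S (X.proj I x) = S' (X.proj I x)) : S = S' := by
  ext y
  obtain ⟨x, rfl⟩ := X.proj_surjective I y
  exact h x

/-- The left action `φ(q(a)) q(x) = q(φ(a) x)` of `A / I` on `X / XI`. -/
noncomputable def φLin : I.Quotient →ₗ[ℂ] (X.QuotCarrier I →L[ℂ] X.QuotCarrier I) :=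
  I.toSubmodule.liftQ
    { toFun := X.φOp I
      map_add' := fun a b => X.clm_ext_proj I fun x => by
        rw [X.φOp_proj, map_add]; rfl
      map_smul' := fun r a => X.clm_ext_proj I fun x => by
        rw [X.φOp_proj, map_smul]; rfl }
    (fun a ha => X.clm_ext_proj I fun x => X.proj_eq_zero I (hI a ha x))

/-- The C⋆-correspondence `X / XI` over `A / I`, for an `X`-invariant ideal `I`. -/
noncomputable def quotient : CStarCorrespondence.{u, v} I.Quotient where
  toHilbertModule := X.toHilbertModule.quotient I
  φ :=
    { toFun := X.φLin I hI
      map_smul' := (X.φLin I hI).map_smul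
      map_zero' := (X.φLin I hI).map_zero
      map_add' := (X.φLin I hI).map_add
      map_mul' := fun a b => by
        obtain ⟨a, rfl⟩ := I.proj_surjective a
        obtain ⟨b, rfl⟩ := I.proj_surjective b
        refine X.clm_ext_proj I fun x => ?_
        change X.proj I (X.φ (a * b) x) = X.proj I (X.φ a (X.φ b x))
        rw [map_mul]
        rfl }
  inner_φ a x y := by
    obtain ⟨a, rfl⟩ := I.proj_surjective a
    obtain ⟨x, rfl⟩ := X.proj_surjective I x
    obtain ⟨y, rfl⟩ := X.proj_surjective I y
    exact congrArg I.proj (X.inner_φ a x y)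

end Quotient

/-- A representation `(π, t)` of `X` in a C⋆-algebra `B`. -/
structure CorrRep (B : Type w) [NonUnitalCStarAlgebra B] where
  π : A →⋆ₙₐ[ℂ] B
  t : X.carrier →ₗ[ℂ] B
  t_rsmul : ∀ x a, t (X.rsmul x a) = t x * π a
  star_t_mul_t : ∀ x y, star (t x) * t y = π (X.inner x y)
  t_φ : ∀ a x, t (X.φ a x) = π a * t x

namespace CorrRep
variable {X} {B : Type w} [NonUnitalCStarAlgebra B]

/-- `(π, t)` is coisometric on `J ⊆ J(X)`: `π a = π₁₁ (φ a)` for `a ∈ J`, where `π₁₁ : K(X) → B` is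
the continuous linear map (which is unique) with `π₁₁ Θ_{x,y} = t(x) t(y)*`. -/
def CoisometricOn (ρ : X.CorrRep B) (J : ClosedIdeal A) : Prop :=
  ∃ π₁₁ : X.compacts →L[ℂ] B,
    (∀ x y, π₁₁ ⟨X.rankOne x y, X.rankOne_mem x y⟩ = ρ.t x * star (ρ.t y)) ∧
    ∀ a ∈ J.toSubmodule, ∀ ha : X.φ a ∈ X.compacts, ρ.π a = π₁₁ ⟨X.φ a, ha⟩

theorem norm_t_le (ρ : X.CorrRep B) (x : X.carrier) : ‖ρ.t x‖ ≤ ‖x‖ := by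
  have h := NonUnitalStarAlgHom.norm_apply_le ρ.π (X.inner x x)
  rw [← ρ.star_t_mul_t, CStarRing.norm_star_mul_self, ← X.norm_sq, ← sq] at h
  exact le_of_sq_le_sq h (norm_nonneg x)
end CorrRep

/-- A representation of `X` coisometric on `J`, in some C⋆-algebra. -/
structure CorrRepIndex (J : ClosedIdeal A) where
  B : Type (max u v)
  [instB : NonUnitalCStarAlgebra B]
  rep : X.CorrRep B
  coisometric : rep.CoisometricOn J

attribute [instance] CorrRepIndex.instB

variable {X}

/-- The values of the representation with index `i` on the generators `a ∈ A` and `x ∈ X`. -/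
def CorrRepIndex.value {J : ClosedIdeal A} (i : X.CorrRepIndex J) : A ⊕ X.carrier → i.B :=
  Sum.elim i.rep.π i.rep.t

variable (X)

theorem CorrRepIndex.value_bounded (J : ClosedIdeal A) (g : A ⊕ X.carrier) :
    ∃ C : ℝ, ∀ i : X.CorrRepIndex J, ‖i.value g‖ ≤ C := by
  cases g with
  | inl a => exact ⟨‖a‖, fun i => NonUnitalStarAlgHom.norm_apply_le i.rep.π a⟩
  | inr x => exact ⟨‖x‖, fun i => i.rep.norm_t_le x⟩

/-- The relative Cuntz–Pimsner algebra `O(J,X)`: the universal C⋆-algebra for representations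
of `X` coisometric on `J`. -/
def CuntzPimsner (J : ClosedIdeal A) : Type (max (u + 1) (v + 1)) :=
  univAlg (fun i : X.CorrRepIndex J => i.value) (CorrRepIndex.value_bounded X J)

noncomputable instance (J : ClosedIdeal A) : NonUnitalCStarAlgebra (X.CuntzPimsner J) :=
  univAlg.instCStar _ _

/-- The universal representation of `X` in `O(J,X)`. -/
def univRep (J : ClosedIdeal A) : X.CorrRep (X.CuntzPimsner J) where
  π :=
    { toFun := fun a => ⟨univGen _ (CorrRepIndex.value_bounded X J) (Sum.inl a), univGen_mem _ _ _⟩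
      map_smul' := fun r a => Subtype.ext (Subtype.ext (funext fun i => map_smul i.rep.π r a))
      map_zero' := Subtype.ext (Subtype.ext (funext fun i => map_zero i.rep.π))
      map_add' := fun a b => Subtype.ext (Subtype.ext (funext fun i => map_add i.rep.π a b))
      map_mul' := fun a b => Subtype.ext (Subtype.ext (funext fun i => map_mul i.rep.π a b))
      map_star' := fun a => Subtype.ext (Subtype.ext (funext fun i => map_star i.rep.π a)) }
  t :=
    { toFun := fun x => ⟨univGen _ (CorrRepIndex.value_bounded X J) (Sum.inr x), univGen_mem _ _ _⟩
      map_add' := fun x y => Subtype.ext (Subtype.ext (funext fun i => map_add i.rep.t x y))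
      map_smul' := fun r x => Subtype.ext (Subtype.ext (funext fun i => map_smul i.rep.t r x)) }
  t_rsmul x a := Subtype.ext (Subtype.ext (funext fun i => i.rep.t_rsmul x a))
  star_t_mul_t x y := Subtype.ext (Subtype.ext (funext fun i => i.rep.star_t_mul_t x y))
  t_φ a x := Subtype.ext (Subtype.ext (funext fun i => i.rep.t_φ a x))

/-- Every representation coisometric on `J` integrates uniquely to `O(J,X)`. -/
theorem existsUnique_integrate (J : ClosedIdeal A) {B : Type (max u v)} [NonUnitalCStarAlgebra B]
    (ρ : X.CorrRep B) (hρ : ρ.CoisometricOn J) :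
    ∃! Ψ : X.CuntzPimsner J →⋆ₙₐ[ℂ] B,
      (∀ a, Ψ ((X.univRep J).π a) = ρ.π a) ∧ ∀ x, Ψ ((X.univRep J).t x) = ρ.t x := by
  refine ⟨univEval (fun i : X.CorrRepIndex J => i.value) (CorrRepIndex.value_bounded X J)
    ⟨B, ρ, hρ⟩, ⟨fun a => rfl, fun x => rfl⟩, fun Ψ hΨ => ?_⟩
  refine univAlg_hom_ext _ _ ?_
  rintro (a | x)
  · exact hΨ.1 a
  · exact hΨ.2 x

end CStarCorrespondence

/-! A representation coisometric on `J` kills `R_J`. In the precategory, `π(a) = π(a ⊗ 1)` for `a ∈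
J` passes from `S_{k+1}` to `S_k`, so induction from `S_0 = 0` and contractivity suffice. For a
correspondence, `a ∈ S_{k+1}` gives `φ(a)X ⊆ X S_k`, where `t` vanishes by induction, so `π(a)t(X) =
0`. Hence `π(a)` annihilates the range of `π₁₁`, which contains `π(a)*`, and `π(a)π(a)* = 0`.
Coisometric representations of the given data and of the quotient data therefore correspond to each
other with the same target algebra, and `exists_univAlg_equiv` turns this into an isomorphism of
universal algebras.

The inclusion in the annihilator rests on saturation of `R = R_J`, that is `J ∩ (⊗1)⁻¹(R) ⊆ R`: if
`a ∈ J` and `b ⊗ 1 ∈ R`, then `ab ∈ J` and `(ab) ⊗ 1 ∈ R`, so `ab ∈ R`. Saturation is not formal,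
because `R` is only the closure of the union of the `S_k`, and an element of `S_k` near `c ⊗ 1` need
not come from anything near `c`. The remedy is `exists_map_eq_zero_norm_sub_le`: for self-adjoint
`d`, the norm of the image of `d` under a bounded homomorphism controls the distance from `d` to its
kernel. Applied to `T(n,n) → T(n+1,n+1)/S_k`, it puts `c*c` close to `S_{k+1}`.

For correspondences the homomorphism is the action of `A` on `X / X S_k`. There `φ(c)X ⊆ XR` yields
approximations one vector at a time, while an operator norm is needed. Compactness of `φ(c*c)`,
which comes from `J ⊆ J(X)`, makes the approximation uniform (`comp_φ_mem_closure`).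

Coisometry for a correspondence involves `π₁₁`, so its descent needs such a map on `K(X/XR)`. This
is `exists_π₁₁`, valid for every representation and based on the contractive estimate
`finiteRankGraph_norm_le`. -/

/-! ### Isomorphisms between universal C⋆-algebras. -/

section Universal
open scoped ENNReal
variable {G G' : Type*} {ι ι' : Type*}
  {B : ι → Type*} [∀ i, NonUnitalCStarAlgebra (B i)]
  {B' : ι' → Type*} [∀ j, NonUnitalCStarAlgebra (B' j)]
  {f : ∀ i, G → B i} (hf : ∀ g, ∃ C : ℝ, ∀ i, ‖f i g‖ ≤ C)
  {f' : ∀ j, G' → B' j} (hf' : ∀ g, ∃ C : ℝ, ∀ j, ‖f' j g‖ ≤ C)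

/-- The homomorphism `(xᵢ)ᵢ ↦ (ψⱼ(x_{e j}))ⱼ` of `ℓ^∞`-products of C⋆-algebras. -/
noncomputable def lpReindex (e : ι' → ι) (ψ : ∀ j, B (e j) →⋆ₙₐ[ℂ] B' j) : lp B ∞ →⋆ₙₐ[ℂ] lp B' ∞ where
  toFun x := ⟨fun j => ψ j (x (e j)), memℓp_infty ⟨‖x‖, by
    rintro _ ⟨j, rfl⟩
    exact (NonUnitalStarAlgHom.norm_apply_le (ψ j) _).trans
      (lp.norm_apply_le_norm ENNReal.top_ne_zero x (e j))⟩⟩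
  map_smul' r x := Subtype.ext (funext fun j => map_smul (ψ j) r _)
  map_zero' := Subtype.ext (funext fun j => map_zero (ψ j))
  map_add' x y := Subtype.ext (funext fun j => map_add (ψ j) _ _)
  map_mul' x y := Subtype.ext (funext fun j => map_mul (ψ j) _ _)
  map_star' x := Subtype.ext (funext fun j => map_star (ψ j) _)

theorem norm_lpReindex_le (e : ι' → ι) (ψ : ∀ j, B (e j) →⋆ₙₐ[ℂ] B' j) (x : lp B ∞) :
    ‖lpReindex e ψ x‖ ≤ ‖x‖ :=
  lp.norm_le_of_forall_le (norm_nonneg x) fun j =>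
    (NonUnitalStarAlgHom.norm_apply_le (ψ j) _).trans
      (lp.norm_apply_le_norm ENNReal.top_ne_zero x (e j))

theorem lpReindex_mem (e : ι' → ι) (ψ : ∀ j, B (e j) →⋆ₙₐ[ℂ] B' j) (p : G → G')
    (h : ∀ j g, ψ j (f (e j) g) = f' j (p g)) {x : lp B ∞} (hx : x ∈ univAlg f hf) :
    lpReindex e ψ x ∈ univAlg f' hf' := by
  have hc : Continuous (lpReindex e ψ) := AddMonoidHomClass.continuous_of_bound _ 1
    (fun x => by simpa using norm_lpReindex_le e ψ x)
  refine map_mem_closure hc hx ?_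
  intro y hy
  have hle : NonUnitalStarAlgebra.adjoin ℂ (Set.range (univGen f hf)) ≤
      (NonUnitalStarAlgebra.adjoin ℂ (Set.range (univGen f' hf'))).comap (lpReindex e ψ) := by
    refine NonUnitalStarAlgebra.adjoin_le ?_
    rintro _ ⟨g, rfl⟩
    refine NonUnitalStarAlgebra.subset_adjoin ℂ _ ⟨p g, ?_⟩
    exact Subtype.ext (funext fun j => (h j g).symm)
  exact hle hy

/-- The homomorphism of universal C⋆-algebras that sends the generator `g` to the generator
`p g`. -/
noncomputable def univMap (e : ι' → ι) (ψ : ∀ j, B (e j) →⋆ₙₐ[ℂ] B' j) (p : G → G')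
    (h : ∀ j g, ψ j (f (e j) g) = f' j (p g)) : univAlg f hf →⋆ₙₐ[ℂ] univAlg f' hf' where
  toFun x := ⟨lpReindex e ψ x.1, lpReindex_mem hf hf' e ψ p h x.2⟩
  map_smul' r x := Subtype.ext (map_smul (lpReindex e ψ) r x.1)
  map_zero' := Subtype.ext (map_zero (lpReindex e ψ))
  map_add' x y := Subtype.ext (map_add (lpReindex e ψ) x.1 y.1)
  map_mul' x y := Subtype.ext (map_mul (lpReindex e ψ) x.1 y.1)
  map_star' x := Subtype.ext (map_star (lpReindex e ψ) x.1)

/-- If the representations of two systems of generators and relations correspond to each other,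
then so do the universal C⋆-algebras. -/
theorem exists_univAlg_equiv {p : G → G'} (hp : Function.Surjective p)
    (h : ∀ j, ∃ i, ∃ ψ : B i →⋆ₙₐ[ℂ] B' j, ∀ g, ψ (f i g) = f' j (p g))
    (h' : ∀ i, ∃ j, ∃ ψ : B' j →⋆ₙₐ[ℂ] B i, ∀ g, ψ (f' j (p g)) = f i g) :
    ∃ Φ : univAlg f hf ≃⋆ₐ[ℂ] univAlg f' hf', ∀ g,
      Φ ⟨univGen f hf g, univGen_mem f hf g⟩ =
        ⟨univGen f' hf' (p g), univGen_mem f' hf' (p g)⟩ := by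
  -- In the applications the universal algebra lies in a higher universe than the algebras to which
  -- its universal property applies. The maps in both directions are therefore built coordinatewise
  -- on the `ℓ^∞`-products.
  choose e ψ hψ using h
  choose e' ψ' hψ' using h'
  -- Any section serves: generators with the same image under `p` have the same value in every
  -- representation, by `hψ'`.
  choose s hs using hp
  have hs' : ∀ i g', ψ' i (f' (e' i) g') = f i (s g') := fun i g' => by
    rw [← hψ' i (s g'), hs]
  let Φ := univMap hf hf' e ψ p hψ
  let Ψ := univMap hf' hf e' ψ' s hs'
  have hΦ : ∀ g, Φ ⟨univGen f hf g, univGen_mem f hf g⟩ =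
      ⟨univGen f' hf' (p g), univGen_mem f' hf' (p g)⟩ := fun g =>
    Subtype.ext (Subtype.ext (funext fun j => hψ j g))
  have hΨ : ∀ g, Ψ ⟨univGen f' hf' g, univGen_mem f' hf' g⟩ =
      ⟨univGen f hf (s g), univGen_mem f hf (s g)⟩ := fun g =>
    Subtype.ext (Subtype.ext (funext fun j => hs' j g))
  have h1 : Ψ.comp Φ = NonUnitalStarAlgHom.id ℂ _ := by
    refine univAlg_hom_ext f hf fun g => ?_
    refine (congrArg Ψ (hΦ g)).trans ((hΨ (p g)).trans ?_)
    refine Subtype.ext (Subtype.ext (funext fun i => ?_))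
    change f i (s (p g)) = f i g
    rw [← hψ', hs, hψ']
  have h2 : Φ.comp Ψ = NonUnitalStarAlgHom.id ℂ _ := by
    refine univAlg_hom_ext f' hf' fun g => ?_
    refine (congrArg Φ (hΨ g)).trans ((hΦ (s g)).trans ?_)
    refine Subtype.ext (Subtype.ext (funext fun i => ?_))
    change f' i (p (s g)) = f' i g
    rw [hs]
  exact ⟨{ Φ with
    invFun := Ψ
    left_inv := DFunLike.congr_fun h1
    right_inv := DFunLike.congr_fun h2
    map_smul' := map_smul Φ }, hΦ⟩
end Universal

/-! ### Distance to the kernel of a bounded homomorphism. -/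

section Kernel
variable {A : Type*} [NonUnitalCStarAlgebra A]

/-- A self-adjoint element `d` of a C⋆-algebra is within `M` of the kernel of every bounded
homomorphism `ψ` with `‖ψ d‖ < M`. -/
theorem exists_map_eq_zero_norm_sub_le {E : Type*} [NonUnitalNormedRing E] [NormedSpace ℂ E]
    (ψ : A →ₙₐ[ℂ] E) {C : ℝ} (hψ : ∀ a, ‖ψ a‖ ≤ C * ‖a‖) {d : A} (hd : IsSelfAdjoint d) {M : ℝ}
    (hM : ‖ψ d‖ < M) : ∃ g, ψ g = 0 ∧ ‖d - g‖ ≤ M := by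
  have hM0 : 0 < M := (norm_nonneg _).trans_lt hM
  -- `c` truncates to `[-M, M]`, so `g(d) = d - c(d)` is within `M` of `d`. The function `g`
  -- vanishes for `|t| ≤ M`; outside that interval `s(t) = 1/t`, and `|s| ≤ 1/M` everywhere.
  let c : ℝ → ℝ := fun t => max (-M) (min M t)
  let g : ℝ → ℝ := fun t => t - c t
  let s : ℝ → ℝ := fun t => t / max (t ^ 2) (M ^ 2)
  have hpos : ∀ t : ℝ, 0 < max (t ^ 2) (M ^ 2) := fun t => lt_max_of_lt_right (by positivity)
  have hc : Continuous c := by fun_prop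
  have hg : Continuous g := by fun_prop
  have hs : Continuous s := Continuous.div (by fun_prop) (by fun_prop) fun t => (hpos t).ne'
  have hc0 : c 0 = 0 := by
    simp only [c]
    rw [min_eq_right hM0.le, max_eq_right (by linarith)]
  have hg0 : g 0 = 0 := by simp [g, hc0]
  have hcM : ∀ t, ‖c t‖ ≤ M := fun t => by
    rw [Real.norm_eq_abs, abs_le]
    exact ⟨le_max_left _ _, max_le (by linarith) (min_le_left _ _)⟩
  have hgt : ∀ t, ‖g t‖ ≤ ‖t‖ := fun t => by
    simp only [g, c, Real.norm_eq_abs]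
    rcases le_total M t with h | h
    · rw [min_eq_left h, max_eq_right (by linarith), abs_of_nonneg, abs_of_nonneg] <;> linarith
    · rw [min_eq_right h]
      rcases le_total (-M) t with h' | h'
      · rw [max_eq_right h', sub_self, abs_zero]; exact abs_nonneg t
      · rw [max_eq_left h', abs_of_nonpos, abs_of_nonpos] <;> linarith
  have hsM : ∀ t, ‖s t‖ ≤ M⁻¹ := fun t => by
    simp only [s]
    rw [norm_div, Real.norm_eq_abs, Real.norm_eq_abs, abs_of_pos (hpos t), div_le_iff₀ (hpos t),
      inv_mul_eq_div, le_div_iff₀ hM0]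
    rcases le_total |t| M with h | h
    · refine le_max_of_le_right ?_
      nlinarith
    · refine le_max_of_le_left ?_
      rw [← sq_abs]
      nlinarith [abs_nonneg t]
  have htsg : ∀ t, t * s t * g t = g t := fun t => by
    by_cases h : |t| ≤ M
    · have : g t = 0 := by
        rw [abs_le] at h
        simp only [g, c]
        rw [min_eq_right h.2, max_eq_right h.1, sub_self]
      rw [this, mul_zero]
    · have h2 : M ^ 2 ≤ t ^ 2 := by rw [← sq_abs t]; gcongr; exact (not_le.1 h).le
      have h3 : t * s t = 1 := by
        simp only [s]
        rw [max_eq_left h2, ← mul_div_assoc, ← sq]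
        exact div_self (ne_of_gt (lt_of_lt_of_le (by positivity) h2))
      rw [h3, one_mul]
  -- Since `g = t^n · (g s^n)`, one gets `‖ψ(g(d))‖ ≤ ‖ψ d‖^n · |C| ‖d‖ M^{-n}`, which tends to `0`
  -- because `‖ψ d‖ < M`. This uses no C⋆-structure on `E`, which later is a ring of bounded
  -- operators on a Banach space.
  let k : ℕ → ℝ → ℝ := fun n t => g t * s t ^ n
  have hk : ∀ n, Continuous (k n) := fun n => hg.mul (hs.pow n)
  have hk0 : ∀ n, k n 0 = 0 := fun n => by simp [k, hg0]
  have hstep : ∀ n, cfcₙ (k n) d = d * cfcₙ (k (n + 1)) d := fun n => by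
    have := cfcₙ_mul (fun t : ℝ => t) (k (n + 1)) d (by fun_prop) rfl (hk _).continuousOn (hk0 _)
    rw [cfcₙ_id' ℝ d] at this
    rw [← this]
    refine congrArg (fun f => cfcₙ f d) (funext fun t => ?_)
    change g t * s t ^ n = t * (g t * s t ^ (n + 1))
    conv_lhs => rw [← htsg t]
    ring
  have hknorm : ∀ n, ‖cfcₙ (k n) d‖ ≤ ‖d‖ * M⁻¹ ^ n := fun n => by
    refine norm_cfcₙ_le fun t ht => ?_
    have ht' : ‖t‖ ≤ ‖d‖ := by
      have := norm_apply_le_norm_cfcₙ (fun t : ℝ => t) d ht (by fun_prop) rfl hd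
      rwa [cfcₙ_id' ℝ d] at this
    rw [norm_mul, norm_pow]
    gcongr
    · exact (hgt t).trans ht'
    · exact hsM t
  have hiter : ∀ n, ‖ψ (cfcₙ (k 0) d)‖ ≤ ‖ψ d‖ ^ n * ‖ψ (cfcₙ (k n) d)‖ := fun n => by
    induction n with
    | zero => simp
    | succ n ih =>
      refine ih.trans ?_
      rw [hstep n, map_mul, pow_succ, mul_assoc]
      gcongr
      exact norm_mul_le _ _
  have hbound : ∀ n, ‖ψ (cfcₙ (k 0) d)‖ ≤ (|C| * ‖d‖) * (‖ψ d‖ * M⁻¹) ^ n := fun n => by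
    calc _ ≤ ‖ψ d‖ ^ n * ‖ψ (cfcₙ (k n) d)‖ := hiter n
      _ ≤ ‖ψ d‖ ^ n * (|C| * (‖d‖ * M⁻¹ ^ n)) := by
          gcongr
          refine (hψ _).trans ((mul_le_mul_of_nonneg_right (le_abs_self C) (norm_nonneg _)).trans ?_)
          gcongr
          exact hknorm n
      _ = _ := by rw [mul_pow]; ring
  have hlim : Filter.Tendsto (fun n : ℕ => (|C| * ‖d‖) * (‖ψ d‖ * M⁻¹) ^ n) Filter.atTop (nhds 0) := by
    have := tendsto_pow_atTop_nhds_zero_of_lt_one (r := ‖ψ d‖ * M⁻¹) (by positivity)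
      (by rwa [← div_eq_mul_inv, div_lt_one hM0])
    simpa using this.const_mul (|C| * ‖d‖)
  refine ⟨cfcₙ (k 0) d, norm_le_zero_iff.1 (ge_of_tendsto' hlim hbound), ?_⟩
  have : d - cfcₙ (k 0) d = cfcₙ c d := by
    have h := cfcₙ_sub (fun t : ℝ => t) (k 0) d (by fun_prop) rfl (hk 0).continuousOn (hk0 0)
    rw [cfcₙ_id' ℝ d] at h
    rw [← h]
    refine congrArg (fun f => cfcₙ f d) (funext fun t => ?_)
    simp [k, g]
  rw [this]
  exact norm_cfcₙ_le fun t _ => hcM t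

namespace ClosedIdeal

/-- The kernel element near `d` need not lie in `J`. Multiplying it by a local unit of `J` for `d`
corrects this at the cost of a second `ε`. -/
theorem exists_mem_inter_norm_sub_lt (J I : ClosedIdeal A) {E : Type*} [NonUnitalNormedRing E]
    [NormedSpace ℂ E] (ψ : A →ₙₐ[ℂ] E) {C : ℝ} (hψ : ∀ a, ‖ψ a‖ ≤ C * ‖a‖)
    (hI : ∀ a, ψ a = 0 → a ∈ I.toSubmodule) {d : A} (hd : IsSelfAdjoint d)
    (hJ : d ∈ J.toSubmodule) {ε : ℝ} (hε : ‖ψ d‖ < ε) :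
    ∃ g ∈ (J.inter I).toSubmodule, ‖d - g‖ < 2 * ε := by
  have hε0 : 0 < ε := (norm_nonneg _).trans_lt hε
  obtain ⟨g, hg, hdg⟩ := exists_map_eq_zero_norm_sub_le ψ hψ hd hε
  obtain ⟨e, he, -, hen, -, hde⟩ := J.exists_local_unit hJ hd hε0
  refine ⟨g * e, ⟨J.mul_mem_left' g he, I.mul_mem_right' e (hI g hg)⟩, ?_⟩
  have : d - g * e = (d - d * e) + (d - g) * e := by rw [sub_mul]; abel
  rw [this]
  calc _ ≤ ‖d - d * e‖ + ‖d - g‖ * ‖e‖ :=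
        (norm_add_le _ _).trans (by gcongr; exact norm_mul_le _ _)
    _ ≤ ‖d - d * e‖ + ε * 1 := by gcongr
    _ < 2 * ε := by linarith

/-- This is the C⋆-identity in the quotient `A / I`. -/
theorem mem_of_star_mul_self_mem (I : ClosedIdeal A) {a : A} (h : star a * a ∈ I.toSubmodule) :
    a ∈ I.toSubmodule := by
  have h0 : I.proj (star a * a) = I.proj 0 := I.proj_eq_proj.2 (by rwa [sub_zero])
  have h1 : star (I.proj a) * I.proj a = 0 := h0
  have h2 : I.proj a = I.proj 0 := (CStarRing.star_mul_self_eq_zero_iff _).1 h1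
  simpa using I.proj_eq_proj.1 h2

end ClosedIdeal
end Kernel

/-- The linear map induced by `f` on the image of a surjection whose kernel `f` annihilates. -/
noncomputable def LinearMap.descend {R M N P : Type*} [Ring R] [AddCommGroup M] [AddCommGroup N]
    [AddCommGroup P] [Module R M] [Module R N] [Module R P] (q : M →ₗ[R] N)
    (hq : Function.Surjective q) (f : M →ₗ[R] P) (h : ∀ x, q x = 0 → f x = 0) : N →ₗ[R] P :=
  (q.ker.liftQ f fun x hx => h x hx).comp (q.quotKerEquivOfSurjective hq).symm.toLinearMap

theorem LinearMap.descend_apply {R M N P : Type*} [Ring R] [AddCommGroup M] [AddCommGroup N]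
    [AddCommGroup P] [Module R M] [Module R N] [Module R P] (q : M →ₗ[R] N)
    (hq : Function.Surjective q) (f : M →ₗ[R] P) (h : ∀ x, q x = 0 → f x = 0) (x : M) :
    q.descend hq f h (q x) = f x := by
  have : (q.quotKerEquivOfSurjective hq).symm (q x) = Submodule.Quotient.mk x := by
    rw [LinearEquiv.symm_apply_eq]; rfl
  exact congrArg (q.ker.liftQ f fun x hx => h x hx) this

/-! ### The reduction ideal of a right tensor C⋆-precategory. -/

namespace RightTensorCStarPrecategory
variable {T : RightTensorCStarPrecategory.{u}}

namespace CatIdeal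
variable (J : CatIdeal T)

/-- Because the chain starts at the zero ideal it increases, so the sum of the `S_k` is a directed
union and a single `S_k` suffices in each approximation. -/
theorem saturationStep_zero_le_succ (k : ℕ) :
    J.saturationStep (zero T) k ≤ J.saturationStep (zero T) (k + 1) := by
  induction k with
  | zero => exact fun n m => bot_le
  | succ k ih => exact fun n m a ha => ⟨ha.1, ih _ _ ha.2⟩

theorem saturationStep_zero_monotone (n m : ℕ) :
    Monotone fun k => (J.saturationStep (zero T) k).mor n m :=
  monotone_nat_of_le_succ fun k => J.saturationStep_zero_le_succ k n m

theorem saturationStep_le_reduction (k : ℕ) : J.saturationStep (zero T) k ≤ J.reduction :=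
  fun n m => (le_iSup (fun k => (J.saturationStep (zero T) k).mor n m) k).trans
    (Submodule.le_topologicalClosure _)

/-- The reduction ideal is the closure of the union of the ideals `Sₖ`. -/
theorem mem_reduction_iff {n m : ℕ} {a : T.Hom n m} :
    a ∈ J.reduction.mor n m ↔
      ∀ ε > 0, ∃ k, ∃ s ∈ (J.saturationStep (zero T) k).mor n m, ‖a - s‖ < ε := by
  have h : a ∈ J.reduction.mor n m ↔
      a ∈ closure ((⨆ k, (J.saturationStep (zero T) k).mor n m : Submodule ℂ _) : Set _) := Iff.rfl
  rw [h, Metric.mem_closure_iff]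
  refine forall₂_congr fun ε _ => ?_
  simp only [SetLike.mem_coe,
    Submodule.mem_iSup_of_directed _ (J.saturationStep_zero_monotone n m).directed_le, dist_eq_norm]
  exact ⟨fun ⟨s, ⟨k, hk⟩, hs⟩ => ⟨k, s, hk, hs⟩, fun ⟨k, s, hk, hs⟩ => ⟨s, ⟨k, hk⟩, hs⟩⟩

theorem reduction_induction {n m : ℕ} {V : Submodule ℂ (T.Hom n m)}
    (hV : IsClosed (V : Set (T.Hom n m))) (h : ∀ k, (J.saturationStep (zero T) k).mor n m ≤ V) :
    J.reduction.mor n m ≤ V :=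
  Submodule.topologicalClosure_minimal _ (iSup_le h) hV

/-- Tensoring maps `S_{k+1}` into `S_k` by definition, and `(⊗1)⁻¹(R)` is closed. -/
theorem reduction_invariant : J.reduction.Invariant := fun n m =>
  J.reduction_induction (J.reduction.tensorPreimage.isClosed_mor n m) fun k => by
    cases k with
    | zero => exact bot_le
    | succ k => exact fun a ha => J.saturationStep_le_reduction k _ _ ha.2

/-- The C⋆-inequality modulo `N` moves questions about `T(n,m)` into the C⋆-algebra `T(n,n)`, where
functional calculus is available. -/
theorem mem_of_adj_comp_self_mem (N : CatIdeal T) {n m : ℕ} {a : T.Hom n m}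
    (h : T.comp (T.adj a) a ∈ N.mor n n) : a ∈ N.mor n m := by
  have h1 := norm_adj_comp_self_quotient N a
  have h2 : projHom N (T.comp (T.adj a) a) = 0 := (Submodule.Quotient.mk_eq_zero _).2 h
  rw [h2, norm_zero] at h1
  have h3 : projHom N a = 0 :=
    norm_eq_zero.1 (pow_eq_zero_iff two_ne_zero |>.1 (le_antisymm h1 (by positivity)))
  exact (Submodule.Quotient.mk_eq_zero _).1 h3

/-- The homomorphism `a ↦ a ⊗ 1 + N(n+1,n+1)` on `T(n,n)`. -/
noncomputable def tensorProj (N : CatIdeal T) (n : ℕ) :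
    T.Hom n n →ₙₐ[ℂ] (N.diag (n + 1)).Quotient where
  toFun a := (N.diag (n + 1)).proj (T.tensor a)
  map_smul' r a := congrArg (N.diag (n + 1)).proj (map_smul T.tensor r a)
  map_zero' := congrArg (N.diag (n + 1)).proj (map_zero T.tensor)
  map_add' a b := congrArg (N.diag (n + 1)).proj (map_add T.tensor a b)
  map_mul' a b := congrArg (N.diag (n + 1)).proj (T.tensor_comp a b)

/-- The reduction ideal is `J`-saturated: `J ∩ (⊗1)⁻¹(R) ⊆ R`. -/
theorem mem_reduction_of_tensor_mem {n m : ℕ} {c : T.Hom n m} (hc : c ∈ J.mor n m)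
    (h : T.tensor c ∈ J.reduction.mor (n + 1) (m + 1)) : c ∈ J.reduction.mor n m := by
  refine J.reduction.mem_of_adj_comp_self_mem ?_
  have hd : T.comp (T.adj c) c ∈ J.mor n n := J.comp_mem_left _ hc
  have hds : IsSelfAdjoint (T.comp (T.adj c) c : T.Hom n n) := by
    change T.adj (T.comp (T.adj c) c) = _
    rw [T.adj_comp, T.adj_adj]
  have ht : T.tensor (T.comp (T.adj c) c) ∈ J.reduction.mor (n + 1) (n + 1) := by
    rw [T.tensor_comp]
    exact J.reduction.comp_mem_left _ h
  rw [mem_reduction_iff] at ht ⊢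
  intro ε hε
  -- Half of `ε`, because `exists_mem_inter_norm_sub_lt` loses a factor of two.
  obtain ⟨k, s, hs, hlt⟩ := ht (ε / 2) (by positivity)
  set S := J.saturationStep (zero T) k with hS
  have hψ : ‖S.tensorProj n (T.comp (T.adj c) c)‖ < ε / 2 := by
    refine lt_of_le_of_lt ?_ hlt
    have : S.tensorProj n (T.comp (T.adj c) c)
        = (S.diag (n + 1)).proj (T.tensor (T.comp (T.adj c) c) - s) :=
      (S.diag (n + 1)).proj_eq_proj.2 (by rw [sub_sub_cancel]; exact hs)
    rw [this]
    exact (S.diag (n + 1)).norm_proj_le _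
  -- The kernel of `S.tensorProj n` is `(⊗1)⁻¹(S_k)`, so the element obtained lies in `J ∩
  -- (⊗1)⁻¹(S_k) = S_{k+1}`.
  obtain ⟨g, hg, hgε⟩ := (J.diag n).exists_mem_inter_norm_sub_lt (S.tensorPreimage.diag n)
    (S.tensorProj n) (C := 1)
    (fun a => by
      rw [one_mul]
      exact ((S.diag (n + 1)).norm_proj_le _).trans (norm_tensor_le a))
    (fun a ha => show T.tensor a ∈ S.mor (n + 1) (n + 1) from
      (Submodule.Quotient.mk_eq_zero (S.mor (n + 1) (n + 1))).1 ha) hds hd hψ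
  exact ⟨k + 1, g, hg, by linarith⟩

/-- For the annihilator: if `a ∈ J` and `b ⊗ 1 ∈ R`, then `ab ∈ J` and `(ab) ⊗ 1 = (a ⊗ 1)(b ⊗ 1) ∈
R`, so saturation gives `ab ∈ R`. -/
theorem quotient_reduction_le {K : CatIdeal T} (hJ : J ≤ K.coisometryDomain)
    (hR : J.reduction.Invariant) (hRK : J.reduction ≤ K) :
    J.quotient J.reduction hR J.reduction_le ≤
      (K.quotient J.reduction hR hRK).coisometryDomain.inter
        (kerTensor (RightTensorCStarPrecategory.quotient J.reduction hR)).annihilator := by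
  rintro n m _ ⟨a, ha, rfl⟩
  refine ⟨⟨⟨T.tensor a, (hJ n m ha).1, rfl⟩, ⟨a, (hJ n m ha).2, rfl⟩⟩, ?_⟩
  intro k b hb
  obtain ⟨b, rfl⟩ := projHom_surjective J.reduction b
  have hb' : T.tensor b ∈ J.reduction.mor (k + 1) (n + 1) :=
    (Submodule.Quotient.mk_eq_zero _).1 hb
  refine (Submodule.Quotient.mk_eq_zero _).2
    (J.mem_reduction_of_tensor_mem (J.comp_mem_right b ha) ?_)
  rw [T.tensor_comp]
  exact J.reduction.comp_mem_left _ hb'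

end CatIdeal

theorem IsCategory.quotient (hT : T.IsCategory) (N : CatIdeal T) (hN : N.Invariant) :
    (RightTensorCStarPrecategory.quotient N hN).IsCategory := by
  intro n
  obtain ⟨e, he, he'⟩ := hT n
  refine ⟨projHom N e, fun m a => ?_, fun m a => ?_⟩
  · obtain ⟨a, rfl⟩ := projHom_surjective N a
    exact congrArg (projHom N) (he m a)
  · obtain ⟨a, rfl⟩ := projHom_surjective N a
    exact congrArg (projHom N) (he' m a)

/-! ### Representations of `K` and of `K / N`. -/

namespace TensorRep
variable {K : CatIdeal T} {B : Type w} [NonUnitalCStarAlgebra B]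

/-- A representation coisometric on `J` vanishes on the reduction ideal of `J`. -/
theorem eq_zero_of_mem_reduction (ρ : TensorRep K B) {J : CatIdeal T} (hρ : ρ.CoisometricOn J)
    (hJ : J ≤ K.coisometryDomain) {n m : ℕ} (a : K.mor m n) (ha : a.1 ∈ J.reduction.mor m n) :
    ρ.π n m a = 0 := by
  -- Coisometry lowers `k` but raises both objects by one, so the induction ranges over all `n` and
  -- `m`.
  have hS : ∀ (k n m : ℕ) (a : K.mor m n), a.1 ∈ (J.saturationStep (CatIdeal.zero T) k).mor m n →
      ρ.π n m a = 0 := by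
    intro k
    induction k with
    | zero =>
      intro n m a ha
      have : a = 0 := Subtype.ext ha
      rw [this, map_zero]
    | succ k ih =>
      intro n m a ha
      exact (hρ n m a.1 ha.1 a.2 (hJ m n ha.1).1).trans
        (ih (n + 1) (m + 1) ⟨_, (hJ m n ha.1).1⟩ ha.2)
  refine norm_le_zero_iff.1 (le_of_forall_pos_le_add fun ε hε => ?_)
  -- Contractivity of `ρ` extends the vanishing from the `S_k` to the closure of their union.
  obtain ⟨k, s, hs, hlt⟩ := J.mem_reduction_iff.1 ha ε hε
  have hsK : s ∈ K.mor m n :=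
    (hJ m n (J.reduction_le m n (J.saturationStep_le_reduction k m n hs))).2
  have h : ρ.π n m a = ρ.π n m (a - ⟨s, hsK⟩) := by
    rw [map_sub, hS k n m ⟨s, hsK⟩ hs, sub_zero]
  rw [h, zero_add]
  exact (ρ.norm_le _).trans hlt.le

end TensorRep

section Descent
variable {K N : CatIdeal T} (hN : N.Invariant) (hK : N ≤ K)

/-- The quotient map `K(n,m) → K(n,m) / N(n,m)`. -/
noncomputable def CatIdeal.toQuotientIdeal (n m : ℕ) :
    K.mor n m →ₗ[ℂ] (K.quotient N hN hK).mor n m :=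
  (toQuotient N hN).restrict fun _ ha => Submodule.mem_map_of_mem ha

theorem CatIdeal.toQuotientIdeal_surjective (n m : ℕ) :
    Function.Surjective (CatIdeal.toQuotientIdeal hN hK n m) := by
  rintro ⟨_, a, ha, rfl⟩
  exact ⟨⟨a, ha⟩, rfl⟩

/-- This transports the axiom `map_tensor`, which involves `⊗ 1^k`, along the quotient map in both
directions. -/
theorem tensorIter_toQuotient {n m : ℕ} (k : ℕ) (a : T.Hom n m) :
    tensorIter k (toQuotient N hN a) = toQuotient N hN (tensorIter k a) := by
  induction k with
  | zero => rfl
  | succ k ih => exact congrArg (quotient N hN).tensor ih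

namespace TensorRep
variable {B : Type w} [NonUnitalCStarAlgebra B]

/-- The representation of `K` obtained from a representation of `K / N`. -/
noncomputable def pullback (ρ : TensorRep (K.quotient N hN hK) B) : TensorRep K B where
  π n m := (ρ.π n m).comp (CatIdeal.toQuotientIdeal hN hK m n)
  map_adj a := ρ.map_adj (CatIdeal.toQuotientIdeal hN hK _ _ a)
  map_comp a b := ρ.map_comp (CatIdeal.toQuotientIdeal hN hK _ _ a)
    (CatIdeal.toQuotientIdeal hN hK _ _ b)
  map_tensor {n m l k} a b := by
    refine (ρ.map_tensor (CatIdeal.toQuotientIdeal hN hK _ _ a)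
      (CatIdeal.toQuotientIdeal hN hK _ _ b)).trans ?_
    refine congrArg (ρ.π (n + k) l) (Subtype.ext ?_)
    exact congrArg (fun c => (quotient N hN).comp c (toQuotient N hN b.1))
      (tensorIter_toQuotient hN k a.1)

theorem CoisometricOn.pullback {ρ : TensorRep (K.quotient N hN hK) B} {J : CatIdeal T}
    (hJ : N ≤ J) (h : ρ.CoisometricOn (J.quotient N hN hJ)) :
    (ρ.pullback hN hK).CoisometricOn J := fun n m a ha h1 h2 =>
  h n m (toQuotient N hN a) ⟨a, ha, rfl⟩ ⟨a, h1, rfl⟩ ⟨T.tensor a, h2, rfl⟩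

variable (ρ : TensorRep K B)
  (h : ∀ (n m : ℕ) (a : K.mor m n), a.1 ∈ N.mor m n → ρ.π n m a = 0)

/-- The linear maps on `K / N` induced by a representation of `K` that vanishes on `N`. -/
noncomputable def descendπ (n m : ℕ) : (K.quotient N hN hK).mor m n →ₗ[ℂ] B :=
  (CatIdeal.toQuotientIdeal hN hK m n).descend (CatIdeal.toQuotientIdeal_surjective hN hK m n)
    (ρ.π n m) fun a ha => h n m a
      ((Submodule.Quotient.mk_eq_zero _).1 (congrArg Subtype.val ha))

theorem descendπ_apply (n m : ℕ) (a : K.mor m n) :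
    ρ.descendπ hN hK h n m (CatIdeal.toQuotientIdeal hN hK m n a) = ρ.π n m a :=
  LinearMap.descend_apply _ _ _ _ a

/-- The representation of `K / N` induced by a representation of `K` that vanishes on `N`. -/
noncomputable def descend : TensorRep (K.quotient N hN hK) B where
  π := ρ.descendπ hN hK h
  map_adj {n m} a := by
    obtain ⟨a, rfl⟩ := CatIdeal.toQuotientIdeal_surjective hN hK _ _ a
    rw [descendπ_apply, ρ.map_adj]
    exact (ρ.descendπ_apply hN hK h _ _ _).symm
  map_comp a b := by
    obtain ⟨a, rfl⟩ := CatIdeal.toQuotientIdeal_surjective hN hK _ _ a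
    obtain ⟨b, rfl⟩ := CatIdeal.toQuotientIdeal_surjective hN hK _ _ b
    rw [descendπ_apply, descendπ_apply, ρ.map_comp]
    exact (ρ.descendπ_apply hN hK h _ _ _).symm
  map_tensor {n m l k} a b := by
    obtain ⟨a, rfl⟩ := CatIdeal.toQuotientIdeal_surjective hN hK _ _ a
    obtain ⟨b, rfl⟩ := CatIdeal.toQuotientIdeal_surjective hN hK _ _ b
    rw [descendπ_apply, descendπ_apply, ρ.map_tensor]
    refine (ρ.descendπ_apply hN hK h _ _ _).symm.trans ?_
    refine congrArg (ρ.descendπ hN hK h (n + k) l) (Subtype.ext ?_)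
    exact congrArg (fun c => (quotient N hN).comp c (toQuotient N hN b.1))
      (tensorIter_toQuotient hN k a.1).symm

variable {ρ} in
theorem CoisometricOn.descend {J : CatIdeal T} (hJ : N ≤ J) (hJK : J ≤ K.coisometryDomain)
    (hρ : ρ.CoisometricOn J) :
    (ρ.descend hN hK h).CoisometricOn (J.quotient N hN hJ) := by
  rintro n m _ ⟨a, ha, rfl⟩ h1 h2
  have := hρ n m a ha (hJK _ _ ha).2 (hJK _ _ ha).1
  rw [← ρ.descendπ_apply hN hK h, ← ρ.descendπ_apply hN hK h] at this
  exact this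

end TensorRep
end Descent

/-- `O_T(K,J)` and `O_{T/R}(K/R,J/R)` are isomorphic, for the reduction ideal `R` of `J`. -/
theorem exists_OAlg_equiv {K J : CatIdeal T} (hJ : J ≤ K.coisometryDomain)
    (hR : J.reduction.Invariant) (hRK : J.reduction ≤ K) :
    ∃ Φ : OAlg K J ≃⋆ₐ[ℂ]
        OAlg (K.quotient J.reduction hR hRK) (J.quotient J.reduction hR J.reduction_le),
      ∀ (n m : ℕ) (a : K.mor m n), Φ ((univRep K J).π n m a) =
        (univRep (K.quotient J.reduction hR hRK)
          (J.quotient J.reduction hR J.reduction_le)).π n m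
            ⟨toQuotient J.reduction hR a.1, a.1, a.2, rfl⟩ := by
  let p : (Σ p : ℕ × ℕ, K.mor p.2 p.1) →
      Σ p : ℕ × ℕ, (K.quotient J.reduction hR hRK).mor p.2 p.1 :=
    fun g => ⟨g.1, CatIdeal.toQuotientIdeal hR hRK _ _ g.2⟩
  have hp : Function.Surjective p := by
    rintro ⟨q, b⟩
    obtain ⟨a, rfl⟩ := CatIdeal.toQuotientIdeal_surjective hR hRK _ _ b
    exact ⟨⟨q, a⟩, rfl⟩
  -- Pulling back and descending leave the target algebra unchanged, so the identity is the
  -- comparison map both ways.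
  obtain ⟨Φ, hΦ⟩ := exists_univAlg_equiv (RepIndex.value_bounded K J)
    (RepIndex.value_bounded (K.quotient J.reduction hR hRK)
      (J.quotient J.reduction hR J.reduction_le)) hp
    (fun j => ⟨⟨j.B, j.rep.pullback hR hRK, j.coisometric.pullback hR hRK J.reduction_le⟩,
      NonUnitalStarAlgHom.id ℂ j.B, fun g => rfl⟩)
    (fun i => by
      have h := fun n m a => i.rep.eq_zero_of_mem_reduction i.coisometric hJ (n := n) (m := m) a
      exact ⟨⟨i.B, i.rep.descend hR hRK h, i.coisometric.descend hR hRK h J.reduction_le hJ⟩,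
        NonUnitalStarAlgHom.id ℂ i.B, fun g => i.rep.descendπ_apply hR hRK h _ _ g.2⟩)
  exact ⟨Φ, fun n m a => hΦ ⟨(n, m), a⟩⟩

end RightTensorCStarPrecategory

/-! ### Compact operators on `X` and on `X / XI`. -/

namespace HilbertModule
variable {A : Type u} [NonUnitalCStarAlgebra A] (X : HilbertModule.{u, v} A)

theorem rankOne_apply (x y z : X.carrier) : X.rankOne x y z = X.rsmul x (X.inner y z) := rfl

theorem norm_rankOne_le (x y : X.carrier) : ‖X.rankOne x y‖ ≤ ‖x‖ * ‖y‖ :=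
  LinearMap.mkContinuous_norm_le _ (by positivity) _

theorem continuous_rsmul (x : X.carrier) : Continuous (X.rsmul x) :=
  AddMonoidHomClass.continuous_of_bound (X.rsmul x) ‖x‖ fun a => X.norm_rsmul_le x a

theorem continuous_rankOne (x : X.carrier) : Continuous (X.rankOne x) := by
  -- `Θ_{x,y}` is conjugate-linear in `y`; additivity with a bound is enough for continuity.
  let L : X.carrier →+ (X.carrier →L[ℂ] X.carrier) :=
    AddMonoidHom.mk' (X.rankOne x) fun y z => by
      ext w
      change X.rsmul x (X.inner (y + z) w) = X.rsmul x (X.inner y w) + X.rsmul x (X.inner z w)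
      rw [X.inner_add_left, map_add]
  exact AddMonoidHomClass.continuous_of_bound L ‖x‖ fun y => X.norm_rankOne_le x y

/-- A closed subspace that contains all `Θ_{x,y}` contains `K(X)`. -/
theorem compacts_le {V : Submodule ℂ (X.carrier →L[ℂ] X.carrier)}
    (hV : IsClosed (V : Set (X.carrier →L[ℂ] X.carrier))) (h : ∀ x y, X.rankOne x y ∈ V) :
    X.compacts ≤ V :=
  Submodule.topologicalClosure_minimal _ (Submodule.span_le.2 (by
    rintro _ ⟨x, y, rfl⟩
    exact h x y)) hV

theorem isClosed_compacts : IsClosed (X.compacts : Set (X.carrier →L[ℂ] X.carrier)) :=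
  Submodule.isClosed_topologicalClosure _

/-- `K(X)` is closed, so closed subspaces of it are closed among all operators, and it suffices to
test on the `Θ_{x,y}`. -/
theorem compacts_map_mem {B : Type*} [NormedAddCommGroup B] [NormedSpace ℂ B]
    (f : X.compacts →L[ℂ] B) {W : Submodule ℂ B} (hW : IsClosed (W : Set B))
    (h : ∀ x y, f ⟨X.rankOne x y, X.rankOne_mem x y⟩ ∈ W) (T : X.compacts) : f T ∈ W := by
  have hle : X.compacts ≤ (W.comap (f : X.compacts →ₗ[ℂ] B)).map X.compacts.subtype :=
    X.compacts_le (X.isClosed_compacts.isClosedEmbedding_subtypeVal.isClosedMap _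
      (hW.preimage f.continuous)) fun x y => ⟨⟨_, X.rankOne_mem x y⟩, h x y, rfl⟩
  obtain ⟨S, hS, hST⟩ := hle T.2
  rw [← Subtype.ext hST]
  exact hS

/-- Continuous linear maps on `K(X)` are determined by their values on the `Θ_{x,y}`. -/
theorem compacts_ext {B : Type*} [NormedAddCommGroup B] [NormedSpace ℂ B]
    {f g : X.compacts →L[ℂ] B}
    (h : ∀ x y, f ⟨X.rankOne x y, X.rankOne_mem x y⟩ = g ⟨X.rankOne x y, X.rankOne_mem x y⟩) :
    f = g :=
  ContinuousLinearMap.ext fun T => sub_eq_zero.1 <|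
    X.compacts_map_mem (f - g) (W := ⊥) isClosed_singleton (fun x y => sub_eq_zero.2 (h x y)) T

section Quotient
variable (I : ClosedIdeal A)

/-- The operator `T` may be any bounded lift of `Q`. In the saturation argument it is `φ(d²) - S`
with `S` mapping `X` into `XI`, which bounds the action of `d²` on `X / XI`. -/
theorem norm_le_of_apply_proj {T : X.carrier →L[ℂ] X.carrier}
    {Q : X.QuotCarrier I →L[ℂ] X.QuotCarrier I} (h : ∀ x, Q (X.proj I x) = X.proj I (T x)) :
    ‖Q‖ ≤ ‖T‖ := by
  refine Q.opNorm_le_bound (norm_nonneg _) fun x => ?_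
  refine le_of_forall_pos_le_add fun ε hε => ?_
  -- The summand `1` in the denominator keeps it positive when `T = 0`.
  obtain ⟨y, rfl, hlt⟩ := Submodule.Quotient.norm_mk_lt x (ε := ε / (‖T‖ + 1)) (by positivity)
  calc ‖Q (X.proj I y)‖ = ‖X.proj I (T y)‖ := by rw [h]
    _ ≤ ‖T y‖ := Submodule.Quotient.norm_mk_le _ _
    _ ≤ ‖T‖ * ‖y‖ := T.le_opNorm y
    _ ≤ ‖T‖ * (‖X.proj I y‖ + ε / (‖T‖ + 1)) := by gcongr; exact hlt.le
    _ = ‖T‖ * ‖X.proj I y‖ + ‖T‖ / (‖T‖ + 1) * ε := by ring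
    _ ≤ ‖T‖ * ‖X.proj I y‖ + 1 * ε := by
        gcongr
        rw [div_le_one (by positivity)]
        linarith
    _ = ‖T‖ * ‖X.proj I y‖ + ε := by rw [one_mul]

/-- The operator on `X / XI` induced by an operator on `X` that preserves `XI`. -/
noncomputable def indOp (T : X.carrier →L[ℂ] X.carrier) (hT : ∀ x ∈ X.sub I, T x ∈ X.sub I) :
    X.QuotCarrier I →L[ℂ] X.QuotCarrier I where
  toLinearMap := (X.sub I).mapQ (X.sub I) (T : X.carrier →ₗ[ℂ] X.carrier) hT
  cont := ((X.sub I).isOpenQuotientMap_mkQ.isQuotientMap.continuous_iff).2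
    ((X.sub I).isOpenQuotientMap_mkQ.continuous.comp T.continuous)

theorem quot_clm_ext {S S' : X.QuotCarrier I →L[ℂ] X.QuotCarrier I}
    (h : ∀ x, S (X.proj I x) = S' (X.proj I x)) : S = S' := by
  ext y
  obtain ⟨x, rfl⟩ := X.proj_surjective I y
  exact h x

/-- For `x ∈ XI` the vector `Θ_{y,z}(x) = y⟨z,x⟩` has its coefficient in `I`, and `XI` is closed. -/
theorem compacts_apply_mem_sub {T : X.carrier →L[ℂ] X.carrier} (hT : T ∈ X.compacts) :
    ∀ x ∈ X.sub I, T x ∈ X.sub I := by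
  intro x hx
  let V : Submodule ℂ (X.carrier →L[ℂ] X.carrier) :=
    (X.sub I).comap (ContinuousLinearMap.apply ℂ X.carrier x : _ →ₗ[ℂ] X.carrier)
  have hV : IsClosed (V : Set (X.carrier →L[ℂ] X.carrier)) :=
    (X.isClosed_sub I).preimage (ContinuousLinearMap.apply ℂ X.carrier x).continuous
  exact X.compacts_le hV (fun y z => X.rsmul_mem_sub y (X.inner_mem_of_right hx)) hT

/-- The map that sends a compact operator on `X` to the induced operator on `X / XI`. -/
noncomputable def indCLM :
    X.compacts →L[ℂ] ((X.quotient I).carrier →L[ℂ] (X.quotient I).carrier) :=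
  LinearMap.mkContinuous
    { toFun := fun T => X.indOp I T.1 (X.compacts_apply_mem_sub I T.2)
      map_add' := fun S T => X.quot_clm_ext I fun x => rfl
      map_smul' := fun r T => X.quot_clm_ext I fun x => rfl } 1 fun T => by
    rw [one_mul]
    exact X.norm_le_of_apply_proj I fun x => rfl

theorem indCLM_mem (T : X.compacts) : X.indCLM I T ∈ (X.quotient I).compacts := by
  refine X.compacts_map_mem (X.indCLM I) (X.quotient I).isClosed_compacts (fun x y => ?_) T
  have h : X.indCLM I ⟨X.rankOne x y, X.rankOne_mem x y⟩
      = (X.quotient I).rankOne (X.proj I x) (X.proj I y) :=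
    X.quot_clm_ext I fun _ => rfl
  rw [h]
  exact (X.quotient I).rankOne_mem _ _

/-- The map `K(X) → K(X/XI)`. -/
noncomputable def indCompacts : X.compacts →L[ℂ] (X.quotient I).compacts :=
  (X.indCLM I).codRestrict _ (X.indCLM_mem I)

theorem indCompacts_rankOne (x y : X.carrier) :
    X.indCompacts I ⟨X.rankOne x y, X.rankOne_mem x y⟩ =
      ⟨(X.quotient I).rankOne (X.proj I x) (X.proj I y), (X.quotient I).rankOne_mem _ _⟩ :=
  Subtype.ext (X.quot_clm_ext I fun _ => rfl)

end Quotient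
end HilbertModule

/-! ### The reduction ideal of a C⋆-correspondence. -/

namespace CStarCorrespondence
variable {A : Type u} [NonUnitalCStarAlgebra A] (X : CStarCorrespondence.{u, v} A)

/-- The action `a ↦ φ(a)` of `A` on `X / XI`. -/
noncomputable def φOpHom (I : ClosedIdeal A) :
    A →ₙₐ[ℂ] (X.QuotCarrier I →L[ℂ] X.QuotCarrier I) where
  toFun := X.φOp I
  map_smul' r a := X.clm_ext_proj I fun x => by rw [X.φOp_proj, map_smul]; rfl
  map_zero' := X.clm_ext_proj I fun x => by
    rw [X.φOp_proj, map_zero]; exact map_zero (X.proj I)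
  map_add' a b := X.clm_ext_proj I fun x => by rw [X.φOp_proj, map_add]; rfl
  map_mul' a b := X.clm_ext_proj I fun x => by rw [X.φOp_proj, map_mul]; rfl

/-- For `I = S_k`, this places kernel elements of the action on `X / X S_k` that lie in `J` inside
`S_{k+1}`. -/
theorem mem_preimage_of_φOp_eq_zero {I : ClosedIdeal A} {a : A} (h : X.φOp I a = 0) :
    a ∈ (X.preimage I).toSubmodule := fun x =>
  (Submodule.Quotient.mk_eq_zero (X.sub I)).1
    ((X.φOp_proj I a x).symm.trans (congrArg (fun S => S (X.proj I x)) h))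

theorem sub_mono {I I' : ClosedIdeal A} (h : I.toSubmodule ≤ I'.toSubmodule) :
    X.sub I ≤ X.sub I' := fun _ hx y => h (hx y)

section Reduction
variable (J : ClosedIdeal A)

theorem saturationStep_zero_monotone :
    Monotone fun k => (X.saturationStep J (ClosedIdeal.zero A) k).toSubmodule := by
  refine monotone_nat_of_le_succ fun k => ?_
  induction k with
  | zero => exact bot_le
  | succ k ih => exact fun a ha => ⟨ha.1, fun x => X.sub_mono ih (ha.2 x)⟩

theorem saturationStep_le_reduction (k : ℕ) :
    (X.saturationStep J (ClosedIdeal.zero A) k).toSubmodule ≤ (X.reduction J).toSubmodule :=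
  (le_iSup (fun k => (X.saturationStep J (ClosedIdeal.zero A) k).toSubmodule) k).trans
    (Submodule.le_topologicalClosure _)

/-- The reduction ideal is the closure of the union of the ideals `Sₖ`. -/
theorem mem_reduction_iff {a : A} : a ∈ (X.reduction J).toSubmodule ↔
    a ∈ closure {b | ∃ k, b ∈ (X.saturationStep J (ClosedIdeal.zero A) k).toSubmodule} := by
  have h : a ∈ (X.reduction J).toSubmodule ↔ a ∈ closure
      ((⨆ k, (X.saturationStep J (ClosedIdeal.zero A) k).toSubmodule : Submodule ℂ A) : Set A) :=
    Iff.rfl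
  have hset : {b | ∃ k, b ∈ (X.saturationStep J (ClosedIdeal.zero A) k).toSubmodule} =
      ((⨆ k, (X.saturationStep J (ClosedIdeal.zero A) k).toSubmodule : Submodule ℂ A) : Set A) := by
    ext b
    rw [SetLike.mem_coe,
      Submodule.mem_iSup_of_directed _ (X.saturationStep_zero_monotone J).directed_le]
    rfl
  rw [h, hset]

theorem reduction_induction {V : Submodule ℂ A} (hV : IsClosed (V : Set A))
    (h : ∀ k, (X.saturationStep J (ClosedIdeal.zero A) k).toSubmodule ≤ V) :
    (X.reduction J).toSubmodule ≤ V :=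
  Submodule.topologicalClosure_minimal _ (iSup_le h) hV

theorem reduction_invariant : X.Invariant (X.reduction J) := by
  refine X.reduction_induction J (X.preimage (X.reduction J)).isClosed' fun k => ?_
  cases k with
  | zero => exact bot_le
  | succ k => exact fun a ha x => X.sub_mono (X.saturationStep_le_reduction J k) (ha.2 x)

/-- `X R_J` is the closure of the union of the `X Sₖ`. -/
theorem sub_reduction_subset : (X.sub (X.reduction J) : Set X.carrier) ⊆
    closure {x | ∃ k, x ∈ X.sub (X.saturationStep J (ClosedIdeal.zero A) k)} := by
  have hdir : Directed (· ≤ ·) fun k => X.sub (X.saturationStep J (ClosedIdeal.zero A) k) :=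
    Monotone.directed_le fun k l h => X.sub_mono (X.saturationStep_zero_monotone J h)
  have hset : {x | ∃ k, x ∈ X.sub (X.saturationStep J (ClosedIdeal.zero A) k)} =
      ((⨆ k, X.sub (X.saturationStep J (ClosedIdeal.zero A) k) : Submodule ℂ X.carrier) :
        Set X.carrier) := by
    ext x
    rw [SetLike.mem_coe, Submodule.mem_iSup_of_directed _ hdir]
    rfl
  have hle : X.sub (X.reduction J) ≤
      (⨆ k, X.sub (X.saturationStep J (ClosedIdeal.zero A) k)).topologicalClosure := by
    -- In a product `x · a` only the coefficient `a ∈ R_J` has to be approximated; the description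
    -- of `XI` by inner products would involve all `y` at once.
    rw [X.sub_eq_closedSpan]
    refine Submodule.topologicalClosure_minimal _ (Submodule.span_le.2 ?_)
      (Submodule.isClosed_topologicalClosure _)
    rintro _ ⟨x, a, ha, rfl⟩
    refine map_mem_closure (X.continuous_rsmul x) ((X.mem_reduction_iff J).1 ha) ?_
    rintro b ⟨k, hb⟩
    exact Submodule.mem_iSup_of_mem k (X.rsmul_mem_sub x hb)
  rw [hset]
  exact hle

/-- If `φ(d*)` maps `X` into `X R_J` and `T` is compact, then `T φ(d)` can be approximated by
operators that map `X` into some `X Sₖ`. -/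
theorem comp_φ_mem_closure {d : A} (hd : ∀ x, X.φ (star d) x ∈ X.sub (X.reduction J))
    {T : X.carrier →L[ℂ] X.carrier} (hT : T ∈ X.compacts) :
    T * X.φ d ∈ closure {S : X.carrier →L[ℂ] X.carrier |
      ∃ k, ∀ x, S x ∈ X.sub (X.saturationStep J (ClosedIdeal.zero A) k)} := by
  let U : ℕ → Submodule ℂ (X.carrier →L[ℂ] X.carrier) := fun k =>
    { carrier := {S | ∀ x, S x ∈ X.sub (X.saturationStep J (ClosedIdeal.zero A) k)}
      add_mem' := fun ha hb x => add_mem (ha x) (hb x)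
      zero_mem' := fun x => zero_mem _
      smul_mem' := fun r S hS x => Submodule.smul_mem _ r (hS x) }
  have hdir : Directed (· ≤ ·) U := Monotone.directed_le fun k l h S hS x =>
    X.sub_mono (X.saturationStep_zero_monotone J h) (hS x)
  have hset : {S : X.carrier →L[ℂ] X.carrier |
      ∃ k, ∀ x, S x ∈ X.sub (X.saturationStep J (ClosedIdeal.zero A) k)} =
      ((⨆ k, U k : Submodule ℂ (X.carrier →L[ℂ] X.carrier)) : Set _) := by
    ext S
    rw [SetLike.mem_coe, Submodule.mem_iSup_of_directed _ hdir]
    rfl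
  rw [hset]
  let V : Submodule ℂ (X.carrier →L[ℂ] X.carrier) :=
    (⨆ k, U k).topologicalClosure.comap (LinearMap.mulRight ℂ (X.φ d))
  have hV : IsClosed (V : Set (X.carrier →L[ℂ] X.carrier)) :=
    (Submodule.isClosed_topologicalClosure _).preimage (continuous_mul_const (X.φ d))
  refine X.compacts_le hV (fun x y => ?_) hT
  -- `φ(d)` moves across the inner product. Approximating the single vector `φ(d*)y ∈ X R_J` by some
  -- `z ∈ X S_k` then approximates the whole operator in norm, and `Θ_{x,z}` maps `X` into `X S_k`.
  have h1 : X.rankOne x y * X.φ d = X.rankOne x (X.φ (star d) y) := by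
    ext z
    change X.rsmul x (X.inner y (X.φ d z)) = X.rsmul x (X.inner (X.φ (star d) y) z)
    rw [X.inner_φ, star_star]
  change X.rankOne x y * X.φ d ∈ closure _
  rw [h1]
  refine map_mem_closure (X.continuous_rankOne x) (X.sub_reduction_subset J (hd y)) ?_
  rintro z ⟨k, hz⟩
  exact Submodule.mem_iSup_of_mem k fun w => X.rsmul_mem_sub x (hz w)

/-- The reduction ideal is `J`-saturated: if `a ∈ J` and `φ(a) X ⊆ X R_J`, then `a ∈ R_J`. -/
theorem mem_reduction_of_mem_preimage (hJ : J.toSubmodule ≤ X.idealJ) {c : A}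
    (hc : c ∈ J.toSubmodule) (h : c ∈ (X.preimage (X.reduction J)).toSubmodule) :
    c ∈ (X.reduction J).toSubmodule := by
  -- Two passes, from `c` to `d = c*c` and from `d` to `d*d = d²`: the operator `φ(d²) = φ(d)φ(d)`
  -- has the form `T φ(d)` with `T` compact, as `comp_φ_mem_closure` requires.
  refine (X.reduction J).mem_of_star_mul_self_mem ((X.reduction J).mem_of_star_mul_self_mem ?_)
  set d := star c * c with hd
  have hds : star d = d := by simp [hd]
  have hdJ : d ∈ J.toSubmodule := J.mul_mem_left' _ hc
  have hdR : d ∈ (X.preimage (X.reduction J)).toSubmodule :=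
    (X.preimage (X.reduction J)).mul_mem_left' _ h
  have hφ := X.comp_φ_mem_closure J (d := d) (by rw [hds]; exact hdR) (hJ hdJ)
  rw [hds, X.mem_reduction_iff, Metric.mem_closure_iff]
  intro ε hε
  obtain ⟨S, ⟨k, hS⟩, hlt⟩ := Metric.mem_closure_iff.1 hφ (ε / 2) (by positivity)
  rw [dist_eq_norm] at hlt
  set I := X.saturationStep J (ClosedIdeal.zero A) k with hI
  -- `S` becomes zero modulo `X S_k`, so `φ(d²) - S` also induces the action of `d²` on `X / X S_k`.
  have hψ : ‖X.φOpHom I (d * d)‖ < ε / 2 := by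
    refine lt_of_le_of_lt (X.norm_le_of_apply_proj I (fun x => ?_)) hlt
    change X.proj I (X.φ (d * d) x) = X.proj I (X.φ d (X.φ d x) - S x)
    rw [map_sub, X.proj_eq_zero I (hS x), sub_zero, map_mul]
    rfl
  have hdd : IsSelfAdjoint (d * d) := by
    change star (d * d) = d * d
    rw [star_mul, hds]
  obtain ⟨g, hg, hgε⟩ := J.exists_mem_inter_norm_sub_lt (X.preimage I) (X.φOpHom I) (C := 1)
    (fun a => by
      rw [one_mul]
      exact (X.norm_le_of_apply_proj I (X.φOp_proj I a)).trans
        ((X.φ a).opNorm_le_bound (norm_nonneg a) (X.norm_φ_le a)))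
    (fun a ha => X.mem_preimage_of_φOp_eq_zero ha) hdd (J.mul_mem_left' d hdJ) hψ
  exact ⟨g, ⟨k + 1, hg⟩, by rw [dist_eq_norm]; linarith⟩

/-- This shows that compactness of `φ(a)` passes to the quotient action, and it links the coisometry
conditions on `X` and on `X / XI`. -/
theorem quotient_φ_proj (I : ClosedIdeal A) (hI : X.Invariant I) {a : A}
    (ha : X.φ a ∈ X.compacts) :
    (X.quotient I hI).φ (I.proj a) = (X.indCompacts I ⟨X.φ a, ha⟩).1 :=
  X.clm_ext_proj I fun _ => rfl

/-- For the annihilator: if `a ∈ J` and `b` acts as zero on `X / X R_J`, then `ab ∈ J` and `φ(ab)X ⊆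
X R_J`, so saturation gives `ab ∈ R_J`. -/
theorem quotient_reduction_le (hJ : J.toSubmodule ≤ X.idealJ) (hR : X.Invariant (X.reduction J)) :
    (J.quotient (X.reduction J) (X.reduction_le J)).toSubmodule ≤
      (X.quotient (X.reduction J) hR).idealJ ⊓
        ClosedIdeal.annihilator (X.quotient (X.reduction J) hR).kerφ := by
  rintro _ ⟨a, ha, rfl⟩
  constructor
  · change (X.quotient (X.reduction J) hR).φ ((X.reduction J).proj a) ∈
      (X.quotient (X.reduction J) hR).compacts
    rw [X.quotient_φ_proj _ hR (hJ ha)]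
    exact (X.indCompacts (X.reduction J) ⟨X.φ a, hJ ha⟩).2
  · intro b hb
    obtain ⟨b, rfl⟩ := (X.reduction J).proj_surjective b
    have hb' : b ∈ (X.preimage (X.reduction J)).toSubmodule :=
      X.mem_preimage_of_φOp_eq_zero hb
    exact (Submodule.Quotient.mk_eq_zero _).2 (X.mem_reduction_of_mem_preimage J hJ
      (J.mul_mem_right' b ha) ((X.preimage (X.reduction J)).mul_mem_left' a hb'))

end Reduction
end CStarCorrespondence

/-! ### The map `π₁₁` on compact operators. -/

/-- A bounded linear map that is given on a dense subspace of `K` by its graph `G` extends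
to `K`. -/
theorem Submodule.exists_clm_of_graph {E B : Type*} [NormedAddCommGroup E] [NormedSpace ℂ E]
    [NormedAddCommGroup B] [NormedSpace ℂ B] [CompleteSpace B] (K : Submodule ℂ E)
    (G : Submodule ℂ (E × B)) (hfst : ∀ p ∈ G, p.1 ∈ K) (hnorm : ∀ p ∈ G, ‖p.2‖ ≤ ‖p.1‖)
    (hK : ∀ x ∈ K, x ∈ closure (Prod.fst '' (G : Set (E × B)))) :
    ∃ f : K →L[ℂ] B, ∀ p (hp : p ∈ G), f ⟨p.1, hfst p hp⟩ = p.2 := by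
  -- That `G` is single-valued needs no separate proof: by `hnorm`, the second coordinate vanishes
  -- where the first does.
  let e : G →ₗ[ℂ] K := (LinearMap.fst ℂ E B).restrict hfst
  let f : G →ₗ[ℂ] B := (LinearMap.snd ℂ E B).comp G.subtype
  have hdense : DenseRange e := fun x => by
    rw [closure_subtype]
    refine closure_mono ?_ (hK x.1 x.2)
    rintro _ ⟨p, hp, rfl⟩
    exact ⟨e ⟨p, hp⟩, ⟨⟨p, hp⟩, rfl⟩, rfl⟩
  have hnorm' : ∃ C, ∀ p, ‖f p‖ ≤ C * ‖e p‖ := ⟨1, fun p => by rw [one_mul]; exact hnorm _ p.2⟩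
  exact ⟨f.extendOfNorm e, fun p hp => LinearMap.extendOfNorm_eq hdense hnorm' ⟨p, hp⟩⟩

namespace CStarCorrespondence
variable {A : Type u} [NonUnitalCStarAlgebra A] {X : CStarCorrespondence.{u, v} A}

namespace CorrRep
variable {B : Type w} [NonUnitalCStarAlgebra B] (ρ : X.CorrRep B)

/-- The span of the pairs `(Θ_{x,y}, t(x) t(y)*)`: the graph of `π₁₁` on the finite rank
operators. -/
noncomputable def finiteRankGraph : Submodule ℂ ((X.carrier →L[ℂ] X.carrier) × B) :=
  Submodule.span ℂ {p | ∃ x y, p = (X.rankOne x y, ρ.t x * star (ρ.t y))}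

theorem rankOne_mem_finiteRankGraph (x y : X.carrier) :
    (X.rankOne x y, ρ.t x * star (ρ.t y)) ∈ ρ.finiteRankGraph :=
  Submodule.subset_span ⟨x, y, rfl⟩

theorem finiteRankGraph_fst_mem {p} (hp : p ∈ ρ.finiteRankGraph) : p.1 ∈ X.compacts := by
  have : ρ.finiteRankGraph ≤ X.compacts.comap (LinearMap.fst ℂ _ B) :=
    Submodule.span_le.2 (by rintro _ ⟨x, y, rfl⟩; exact X.rankOne_mem x y)
  exact this hp

theorem mul_star_t_mul_t (x y z : X.carrier) :
    ρ.t x * star (ρ.t y) * ρ.t z = ρ.t (X.rankOne x y z) := by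
  rw [mul_assoc, ρ.star_t_mul_t, X.rankOne_apply, ρ.t_rsmul]

/-- This is the link between products in `B` and composition of operators: the second coordinate
acts on `t(X)` as the first acts on `X`. -/
theorem finiteRankGraph_mul_t {p} (hp : p ∈ ρ.finiteRankGraph) (z : X.carrier) :
    p.2 * ρ.t z = ρ.t (p.1 z) := by
  induction hp using Submodule.span_induction with
  | mem p hp =>
    obtain ⟨x, y, rfl⟩ := hp
    exact ρ.mul_star_t_mul_t x y z
  | zero => simp
  | add p q _ _ h1 h2 =>
    rw [Prod.snd_add, Prod.fst_add, add_mul, h1, h2, add_apply, map_add]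
  | smul r p _ h =>
    rw [Prod.smul_snd, Prod.smul_fst, smul_mul_assoc, h, smul_apply, map_smul]

/-- The operators are merely bounded and carry no adjoint, so one is produced together with the
adjoint in `B`, from `Θ_{x,y}* = Θ_{y,x}`. -/
theorem exists_adjoint_mem_finiteRankGraph {p} (hp : p ∈ ρ.finiteRankGraph) :
    ∃ F, (F, star p.2) ∈ ρ.finiteRankGraph ∧ ∀ x y, X.inner (p.1 x) y = X.inner x (F y) := by
  induction hp using Submodule.span_induction with
  | mem p hp =>
    obtain ⟨x, y, rfl⟩ := hp
    refine ⟨X.rankOne y x, ?_, fun a b => ?_⟩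
    · rw [star_mul, star_star]
      exact ρ.rankOne_mem_finiteRankGraph y x
    · rw [X.rankOne_apply, X.rankOne_apply, X.inner_rsmul_left, X.inner_rsmul, X.star_inner]
  | zero =>
    refine ⟨0, by rw [Prod.snd_zero, star_zero]; exact zero_mem _, fun x y => ?_⟩
    change X.inner (0 : X.carrier) y = X.inner x 0
    have h : ∀ z, X.inner z 0 = 0 := fun z => map_zero (X.innerCLM z)
    rw [← X.star_inner, h, h, star_zero]
  | add p q _ _ h1 h2 =>
    obtain ⟨F, hF, hF'⟩ := h1
    obtain ⟨G, hG, hG'⟩ := h2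
    refine ⟨F + G, ?_, fun x y => ?_⟩
    · rw [Prod.snd_add, star_add]
      exact add_mem hF hG
    · rw [Prod.fst_add, add_apply, add_apply,
        X.inner_add_left, X.inner_add, hF', hG']
  | smul r p _ h =>
    obtain ⟨F, hF, hF'⟩ := h
    refine ⟨star r • F, ?_, fun x y => ?_⟩
    · rw [Prod.smul_snd, star_smul]
      exact Submodule.smul_mem _ (star r) hF
    · rw [Prod.smul_fst, smul_apply, smul_apply,
        X.inner_smul_left, X.inner_smul, hF']

/-- The constant comes from an expansion of `p` into rank-one pairs and is crude. Only its
independence of `E` and `e` matters, since taking powers removes it. -/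
theorem exists_norm_mul_le {p} (hp : p ∈ ρ.finiteRankGraph) :
    ∃ C : ℝ, ∀ (E : X.carrier →L[ℂ] X.carrier) (e : B), (∀ z, e * ρ.t z = ρ.t (E z)) →
      ‖e * p.2‖ ≤ C * ‖E‖ := by
  induction hp using Submodule.span_induction with
  | mem p hp =>
    obtain ⟨x, y, rfl⟩ := hp
    refine ⟨‖x‖ * ‖y‖, fun E e h => ?_⟩
    rw [← mul_assoc, h]
    calc _ ≤ ‖ρ.t (E x)‖ * ‖star (ρ.t y)‖ := norm_mul_le _ _
      _ ≤ (‖E‖ * ‖x‖) * ‖y‖ := by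
          rw [norm_star]
          gcongr
          · exact (ρ.norm_t_le _).trans (E.le_opNorm x)
          · exact ρ.norm_t_le y
      _ = _ := by ring
  | zero => exact ⟨0, fun E e _ => by simp⟩
  | add p q _ _ h1 h2 =>
    obtain ⟨C, hC⟩ := h1
    obtain ⟨D, hD⟩ := h2
    refine ⟨C + D, fun E e h => ?_⟩
    rw [Prod.snd_add, mul_add, add_mul]
    exact (norm_add_le _ _).trans (add_le_add (hC E e h) (hD E e h))
  | smul r p _ h =>
    obtain ⟨C, hC⟩ := h
    refine ⟨‖r‖ * C, fun E e h => ?_⟩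
    rw [Prod.smul_snd, mul_smul_comm, norm_smul, mul_assoc]
    gcongr
    exact hC E e h

/-- Since `‖h^(2^m)‖ = ‖h‖^(2^m)` for self-adjoint `h`, the constant `D` disappears in the limit of
high powers. -/
theorem norm_le_of_norm_pow_le {E : Type*} [NormedRing E] [StarRing E] [CStarRing E] {h : E}
    (hh : IsSelfAdjoint h) {D r : ℝ} (hr : 0 ≤ r) (hD : ∀ n : ℕ, ‖h ^ (n + 2)‖ ≤ D * r ^ (n + 1)) :
    ‖h‖ ≤ r := by
  by_contra! hlt
  have h0 : 0 < ‖h‖ := hr.trans_lt hlt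
  have key : ∀ m : ℕ, ‖h‖ ≤ D * (r / ‖h‖) ^ (2 ^ (m + 1) - 1) := fun m => by
    -- The exponent `m + 1` makes the power of two at least `2`, so that `hD` applies.
    obtain ⟨n, hn⟩ : ∃ n, 2 ^ (m + 1) = n + 2 :=
      ⟨2 ^ (m + 1) - 2, (Nat.sub_add_cancel (by rw [pow_succ]; have := Nat.one_le_two_pow (n := m); omega)).symm⟩
    have h1 := hh.norm_pow_two_pow (m + 1)
    rw [hn] at h1
    have h2 := hD n
    rw [h1] at h2
    have h3 : n + 2 - 1 = n + 1 := rfl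
    rw [hn, h3, div_pow, ← mul_div_assoc, le_div_iff₀ (by positivity), ← pow_succ']
    exact h2
  have hlim : Filter.Tendsto (fun m : ℕ => D * (r / ‖h‖) ^ (2 ^ (m + 1) - 1)) Filter.atTop
      (nhds (D * 0)) := by
    refine Filter.Tendsto.const_mul D ((tendsto_pow_atTop_nhds_zero_of_lt_one (by positivity)
      (by rwa [div_lt_one h0])).comp ?_)
    refine Filter.tendsto_atTop_mono (fun m => ?_) Filter.tendsto_id
    have := Nat.lt_two_pow_self (n := m + 1)
    simp only [id]
    omega
  rw [mul_zero] at hlim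
  exact h0.not_ge (ge_of_tendsto' hlim key)

/-- For `p = (F, f)` with adjoint `F'` of `F`, put `h = f f*`. Then `h^(n+1)` acts on `t(X)` as
`(FF')^(n+1)`, so `h^(n+2) = (h^(n+1) f) f*` has norm at most `|C| ‖f‖ (‖F‖²)^(n+1)`. The power
lemma yields `‖f‖² = ‖h‖ ≤ ‖F‖²`. -/
theorem finiteRankGraph_norm_le {p} (hp : p ∈ ρ.finiteRankGraph) : ‖p.2‖ ≤ ‖p.1‖ := by
  obtain ⟨F, f⟩ := p
  obtain ⟨F', hF', hadj⟩ := ρ.exists_adjoint_mem_finiteRankGraph hp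
  obtain ⟨C, hC⟩ := ρ.exists_norm_mul_le hp
  simp only at hF' hadj hC ⊢
  have hC0 : 0 ≤ |C| := abs_nonneg C
  have hFF : ‖F'‖ ≤ ‖F‖ := by
    refine F'.opNorm_le_bound (norm_nonneg _) fun x => ?_
    rcases (norm_nonneg (F' x)).eq_or_lt with h0 | h0
    · rw [← h0]; positivity
    · refine le_of_mul_le_mul_right ?_ h0
      calc ‖F' x‖ * ‖F' x‖ = ‖X.inner (F (F' x)) x‖ := by rw [hadj, ← sq, X.norm_sq]
        _ ≤ ‖F (F' x)‖ * ‖x‖ := X.norm_inner_le _ _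
        _ ≤ ‖F‖ * ‖F' x‖ * ‖x‖ := by gcongr; exact F.le_opNorm _
        _ = ‖F‖ * ‖x‖ * ‖F' x‖ := by ring
  set h := f * star f with hh
  have ht : ∀ z, h * ρ.t z = ρ.t ((F * F') z) := fun z => by
    have h1 : star f * ρ.t z = ρ.t (F' z) := ρ.finiteRankGraph_mul_t hF' z
    have h2 : f * ρ.t (F' z) = ρ.t (F (F' z)) := ρ.finiteRankGraph_mul_t hp (F' z)
    rw [hh, mul_assoc, h1, h2]
    rfl
  -- Powers are formed in the unitization because `B` need not be unital; the exponent `n + 1` keeps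
  -- them in `B`.
  have hq : ∀ n : ℕ, ∃ q : B, (q : Unitization ℂ B) = (h : Unitization ℂ B) ^ (n + 1) ∧
      ∀ z, q * ρ.t z = ρ.t (((F * F') ^ (n + 1)) z) := by
    intro n
    induction n with
    | zero => exact ⟨h, by simp, fun z => by simpa using ht z⟩
    | succ n ih =>
      obtain ⟨q, hq1, hq2⟩ := ih
      refine ⟨q * h, by rw [Unitization.inr_mul, hq1, ← pow_succ], fun z => ?_⟩
      rw [mul_assoc, ht, hq2, pow_succ (F * F') (n + 1)]
      rfl
  have hhs : IsSelfAdjoint (h : Unitization ℂ B) := by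
    change star (h : Unitization ℂ B) = h
    rw [← Unitization.inr_star, hh, star_mul, star_star]
  have hle : ‖(h : Unitization ℂ B)‖ ≤ ‖F‖ * ‖F‖ := by
    refine norm_le_of_norm_pow_le hhs (D := |C| * ‖f‖) (by positivity) fun n => ?_
    obtain ⟨q, hq1, hq2⟩ := hq n
    rw [pow_succ, ← hq1, ← Unitization.inr_mul, Unitization.norm_inr, hh, ← mul_assoc]
    calc ‖q * f * star f‖ ≤ ‖q * f‖ * ‖f‖ := (norm_mul_le _ _).trans (by rw [norm_star])
      _ ≤ |C| * (‖F‖ * ‖F‖) ^ (n + 1) * ‖f‖ := by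
          gcongr
          refine (hC _ q hq2).trans ((mul_le_mul_of_nonneg_right (le_abs_self C)
            (norm_nonneg _)).trans ?_)
          gcongr
          refine (norm_pow_le' _ n.succ_pos).trans ?_
          gcongr
          exact (norm_mul_le F F').trans (by gcongr)
      _ = _ := by ring
  rw [Unitization.norm_inr, hh, CStarRing.norm_self_mul_star] at hle
  exact le_of_sq_le_sq (by rwa [sq, sq]) (norm_nonneg _)

/-- For every representation there is a continuous linear map `π₁₁` on `K(X)` with
`π₁₁ Θ_{x,y} = t(x) t(y)*`. -/
theorem exists_π₁₁ : ∃ π₁₁ : X.compacts →L[ℂ] B,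
    ∀ x y, π₁₁ ⟨X.rankOne x y, X.rankOne_mem x y⟩ = ρ.t x * star (ρ.t y) := by
  have hK : ∀ T ∈ X.compacts, T ∈ closure
      (Prod.fst '' (ρ.finiteRankGraph : Set ((X.carrier →L[ℂ] X.carrier) × B))) := fun T hT => by
    have hle := X.compacts_le
      (V := (ρ.finiteRankGraph.map (LinearMap.fst ℂ _ B)).topologicalClosure)
      (Submodule.isClosed_topologicalClosure _) fun x y =>
        Submodule.le_topologicalClosure _ ⟨_, ρ.rankOne_mem_finiteRankGraph x y, rfl⟩
    exact hle hT
  obtain ⟨f, hf⟩ := X.compacts.exists_clm_of_graph ρ.finiteRankGraph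
    (fun _ hp => ρ.finiteRankGraph_fst_mem hp) (fun _ hp => ρ.finiteRankGraph_norm_le hp) hK
  exact ⟨f, fun x y => hf _ (ρ.rankOne_mem_finiteRankGraph x y)⟩

/-! ### Representations of `X` and of `X / XI`. -/

theorem t_eq_zero {I : ClosedIdeal A} (h : ∀ a ∈ I.toSubmodule, ρ.π a = 0) {x : X.carrier}
    (hx : x ∈ X.sub I) : ρ.t x = 0 := by
  rw [← CStarRing.star_mul_self_eq_zero_iff, ρ.star_t_mul_t]
  exact h _ (hx x)

/-- A representation coisometric on `J` vanishes on the reduction ideal of `J`. -/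
theorem eq_zero_of_mem_reduction {J : ClosedIdeal A} (hρ : ρ.CoisometricOn J)
    (hJ : J.toSubmodule ≤ X.idealJ) : ∀ a ∈ (X.reduction J).toSubmodule, ρ.π a = 0 := by
  obtain ⟨π₁₁, h11, hco⟩ := hρ
  have hcont : Continuous ρ.π := AddMonoidHomClass.continuous_of_bound ρ.π 1
    (fun a => by simpa using NonUnitalStarAlgHom.norm_apply_le ρ.π a)
  refine X.reduction_induction J (V := LinearMap.ker (ρ.π : A →ₗ[ℂ] B))
    (isClosed_singleton.preimage hcont) fun k => ?_
  induction k with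
  | zero => exact bot_le
  | succ k ih =>
    intro a ha
    have ht : ∀ z, ρ.π a * ρ.t z = 0 := fun z => by
      rw [← ρ.t_φ]
      exact ρ.t_eq_zero ih (ha.2 z)
    -- `π(a)` annihilates `t(X)`, hence every `t(x)t(y)*` and, by continuity, the range of `π₁₁`.
    have h1 : (ContinuousLinearMap.mul ℂ B (ρ.π a)).comp π₁₁ = 0 := by
      refine X.compacts_ext fun x y => ?_
      change ρ.π a * π₁₁ _ = 0
      rw [h11, ← mul_assoc, ht, zero_mul]
    -- Coisometry is used at `a* ∈ J`: it puts `π(a)* = π₁₁(φ(a*))` into the range that `π(a)`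
    -- annihilates.
    have h2 : ρ.π a * star (ρ.π a) = 0 := by
      rw [← map_star, hco _ (J.star_mem ha.1) (hJ (J.star_mem ha.1))]
      exact congrArg (fun L => L ⟨X.φ (star a), hJ (J.star_mem ha.1)⟩) h1
    exact (CStarRing.mul_star_self_eq_zero_iff _).1 h2

section Descent
variable {I : ClosedIdeal A} (hI : X.Invariant I)

/-- The representation of `X` obtained from a representation of `X / XI`. -/
noncomputable def pullback (ρ : (X.quotient I hI).CorrRep B) : X.CorrRep B where
  π :=
    { toFun := fun a => ρ.π (I.proj a)
      map_smul' := fun r a => map_smul ρ.π r (I.proj a)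
      map_zero' := map_zero ρ.π
      map_add' := fun a b => map_add ρ.π (I.proj a) (I.proj b)
      map_mul' := fun a b => map_mul ρ.π (I.proj a) (I.proj b)
      map_star' := fun a => map_star ρ.π (I.proj a) }
  t := ρ.t.comp (X.proj I)
  t_rsmul x a := ρ.t_rsmul (X.proj I x) (I.proj a)
  star_t_mul_t x y := ρ.star_t_mul_t (X.proj I x) (X.proj I y)
  t_φ a x := ρ.t_φ (I.proj a) (X.proj I x)

theorem CoisometricOn.pullback {ρ : (X.quotient I hI).CorrRep B} {J : ClosedIdeal A}
    (hIJ : I.toSubmodule ≤ J.toSubmodule) (h : ρ.CoisometricOn (J.quotient I hIJ)) : (ρ.pullback hI).CoisometricOn J := by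
  obtain ⟨π₁₁, h11, hco⟩ := h
  refine ⟨π₁₁.comp (X.indCompacts I), fun x y => ?_, fun a ha hφ => ?_⟩
  · exact (congrArg π₁₁ (X.indCompacts_rankOne I x y)).trans (h11 (X.proj I x) (X.proj I y))
  · have h1 := X.quotient_φ_proj I hI hφ
    refine (hco (I.proj a) ⟨a, ha, rfl⟩ ?_).trans (congrArg π₁₁ (Subtype.ext h1))
    rw [h1]
    exact (X.indCompacts I ⟨X.φ a, hφ⟩).2

variable (ρ : X.CorrRep B) (h : ∀ a ∈ I.toSubmodule, ρ.π a = 0)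

/-- The homomorphism on `A / I` induced by a representation that vanishes on `I`. -/
noncomputable def descendπ : I.Quotient →⋆ₙₐ[ℂ] B :=
  let f : I.Quotient →ₗ[ℂ] B := I.toSubmodule.liftQ (ρ.π : A →ₗ[ℂ] B) h
  { toFun := f
    map_smul' := map_smul f
    map_zero' := map_zero f
    map_add' := map_add f
    map_mul' := fun a b => by
      obtain ⟨a, rfl⟩ := I.proj_surjective a
      obtain ⟨b, rfl⟩ := I.proj_surjective b
      exact map_mul ρ.π a b
    map_star' := fun a => by
      obtain ⟨a, rfl⟩ := I.proj_surjective a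
      exact map_star ρ.π a }

/-- The representation of `X / XI` induced by a representation of `X` that vanishes on `I`. -/
noncomputable def descend : (X.quotient I hI).CorrRep B where
  π := ρ.descendπ h
  t := (X.sub I).liftQ ρ.t fun _ hx => ρ.t_eq_zero h hx
  t_rsmul x a := by
    obtain ⟨x, rfl⟩ := X.proj_surjective I x
    obtain ⟨a, rfl⟩ := I.proj_surjective a
    exact ρ.t_rsmul x a
  star_t_mul_t x y := by
    obtain ⟨x, rfl⟩ := X.proj_surjective I x
    obtain ⟨y, rfl⟩ := X.proj_surjective I y
    exact ρ.star_t_mul_t x y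
  t_φ a x := by
    obtain ⟨a, rfl⟩ := I.proj_surjective a
    obtain ⟨x, rfl⟩ := X.proj_surjective I x
    exact ρ.t_φ a x

-- The given `π₁₁` lives on `K(X)` and is not visibly trivial on the kernel of `K(X) → K(X/XI)`.
-- Instead `exists_π₁₁` supplies `σ` for the descended representation; `σ` composed with
-- `X.indCompacts I` agrees with `π₁₁` on the `Θ_{x,y}`, hence everywhere, and evaluation at `φ(a)`
-- transfers coisometry.
variable {ρ} in
theorem CoisometricOn.descend {J : ClosedIdeal A} (hIJ : I.toSubmodule ≤ J.toSubmodule)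
    (hJ : J.toSubmodule ≤ X.idealJ) (hρ : ρ.CoisometricOn J) :
    (ρ.descend hI h).CoisometricOn (J.quotient I hIJ) := by
  obtain ⟨π₁₁, h11, hco⟩ := hρ
  obtain ⟨σ, hσ⟩ := (ρ.descend hI h).exists_π₁₁
  refine ⟨σ, hσ, ?_⟩
  have hind : σ.comp (X.indCompacts I) = π₁₁ := X.compacts_ext fun x y =>
    (congrArg σ (X.indCompacts_rankOne I x y)).trans
      ((hσ (X.proj I x) (X.proj I y)).trans (h11 x y).symm)
  rintro _ ⟨a, ha, rfl⟩ hφ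
  refine (hco a ha (hJ ha)).trans ?_
  rw [← hind]
  exact congrArg σ (Subtype.ext (X.quotient_φ_proj I hI (hJ ha)).symm)

end Descent
end CorrRep

/-- `O(J,X)` and `O(J/R,X/XR)` are isomorphic, for the reduction ideal `R` of `J`. -/
theorem exists_CuntzPimsner_equiv (J : ClosedIdeal A) (hJ : J.toSubmodule ≤ X.idealJ)
    (hR : X.Invariant (X.reduction J)) :
    ∃ Φ : X.CuntzPimsner J ≃⋆ₐ[ℂ]
        (X.quotient (X.reduction J) hR).CuntzPimsner
          (J.quotient (X.reduction J) (X.reduction_le J)),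
      (∀ a : A, Φ ((X.univRep J).π a) =
        ((X.quotient (X.reduction J) hR).univRep
          (J.quotient (X.reduction J) (X.reduction_le J))).π ((X.reduction J).proj a)) ∧
      ∀ x : X.carrier, Φ ((X.univRep J).t x) =
        ((X.quotient (X.reduction J) hR).univRep
          (J.quotient (X.reduction J) (X.reduction_le J))).t
            (X.toHilbertModule.proj (X.reduction J) x) := by
  let p : A ⊕ X.carrier → (X.reduction J).Quotient ⊕ (X.quotient (X.reduction J) hR).carrier :=
    Sum.map (X.reduction J).proj (X.proj (X.reduction J))
  have hp : Function.Surjective p :=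
    (X.reduction J).proj_surjective.sumMap (X.proj_surjective (X.reduction J))
  obtain ⟨Φ, hΦ⟩ := exists_univAlg_equiv (CorrRepIndex.value_bounded X J)
    (CorrRepIndex.value_bounded (X.quotient (X.reduction J) hR)
      (J.quotient (X.reduction J) (X.reduction_le J))) hp
    (fun j => ⟨⟨j.B, j.rep.pullback hR, j.coisometric.pullback hR (X.reduction_le J)⟩,
      NonUnitalStarAlgHom.id ℂ j.B, by rintro (a | x) <;> rfl⟩)
    (fun i => ⟨⟨i.B, i.rep.descend hR (i.rep.eq_zero_of_mem_reduction i.coisometric hJ),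
        i.coisometric.descend hR _ (X.reduction_le J) hJ⟩,
      NonUnitalStarAlgHom.id ℂ i.B, by rintro (a | x) <;> rfl⟩)
  exact ⟨Φ, fun a => hΦ (Sum.inl a), fun x => hΦ (Sum.inr x)⟩

end CStarCorrespondence

theorem mainTheorem9 :
    (∀ (T : RightTensorCStarPrecategory.{u}) (K J : RightTensorCStarPrecategory.CatIdeal T),
      J ≤ K.coisometryDomain →
      ∃ (hR : J.reduction.Invariant) (hRK : J.reduction ≤ K),
        (T.IsCategory → (RightTensorCStarPrecategory.quotient J.reduction hR).IsCategory) ∧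
        J.quotient J.reduction hR J.reduction_le ≤
          (K.quotient J.reduction hR hRK).coisometryDomain.inter
            (RightTensorCStarPrecategory.CatIdeal.kerTensor
              (RightTensorCStarPrecategory.quotient J.reduction hR)).annihilator ∧
        ∃ Φ : RightTensorCStarPrecategory.OAlg K J ≃⋆ₐ[ℂ]
            RightTensorCStarPrecategory.OAlg (K.quotient J.reduction hR hRK)
              (J.quotient J.reduction hR J.reduction_le),
          ∀ (n m : ℕ) (a : K.mor m n),
            Φ ((RightTensorCStarPrecategory.univRep K J).π n m a) =
              (RightTensorCStarPrecategory.univRep (K.quotient J.reduction hR hRK)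
                (J.quotient J.reduction hR J.reduction_le)).π n m
                  ⟨RightTensorCStarPrecategory.toQuotient J.reduction hR a.1, a.1, a.2, rfl⟩) ∧
    (∀ (A : Type v) [NonUnitalCStarAlgebra A] (X : CStarCorrespondence.{v, w} A)
        (J : ClosedIdeal A),
      J.toSubmodule ≤ X.idealJ →
      ∃ hR : X.Invariant (X.reduction J),
        (J.quotient (X.reduction J) (X.reduction_le J)).toSubmodule ≤
          (X.quotient (X.reduction J) hR).idealJ ⊓
            ClosedIdeal.annihilator (X.quotient (X.reduction J) hR).kerφ ∧
        ∃ Φ : X.CuntzPimsner J ≃⋆ₐ[ℂ]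
            (X.quotient (X.reduction J) hR).CuntzPimsner
              (J.quotient (X.reduction J) (X.reduction_le J)),
          (∀ a : A, Φ ((X.univRep J).π a) =
            ((X.quotient (X.reduction J) hR).univRep
              (J.quotient (X.reduction J) (X.reduction_le J))).π ((X.reduction J).proj a)) ∧
          ∀ x : X.carrier, Φ ((X.univRep J).t x) =
            ((X.quotient (X.reduction J) hR).univRep
              (J.quotient (X.reduction J) (X.reduction_le J))).t
                (X.toHilbertModule.proj (X.reduction J) x)) := by
  refine ⟨fun T K J hJ => ?_, fun A _ X J hJ => ?_⟩
  · have hRK : J.reduction ≤ K := fun n m a ha => (hJ n m (J.reduction_le n m ha)).2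
    exact ⟨J.reduction_invariant, hRK, fun hT => hT.quotient _ J.reduction_invariant,
      J.quotient_reduction_le hJ _ _,
      RightTensorCStarPrecategory.exists_OAlg_equiv hJ J.reduction_invariant hRK⟩
  · exact ⟨X.reduction_invariant J, X.quotient_reduction_le J hJ _,
      CStarCorrespondence.exists_CuntzPimsner_equiv J hJ (X.reduction_invariant J)⟩
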